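/- **Signals.** Let $\mathcal F$ be the set of differentiable $f:\mathbb R_{\ge 0}\to\mathbb R$ with Lipschitz-continuous derivative, $\mathcal F_L=\{f\in\mathcal F: |\ddot f(t)|\le L \text{ for a.e. } t\ge 0\}$, and, for $\mathbf R=(R_0,R_1)\in\mathbb R_{\ge0}^2$, $\mathcal F_L^{\mathbf R}=\{f\in\mathcal F_L: |f(0)|\le R_0,\ |\dot f(0)|\le R_1\}$. Let $\mathcal E_N$ be the set of (not necessarily measurable) $\eta:\mathbb R_{\ge0}\to\mathbb R$ with $|\eta(t)|\le N$ for all $t\ge0$, and $\mathcal U=\bigcup_{L\ge 0,N\ge 0}(\mathcal F_L+\mathcal E_N)$. **Performance measures.** For an operator $\mathcal D:\mathcal U\to(\mathbb R_{\ge0}\to\mathbb R)$ put $$M_N^{L,\mathbf R}(t)=\sup_{f\in\mathcal F_L^{\mathbf R},\,\eta\in\mathcal E_N}\ \sup_{\tau\ge t}|\dot f(\tau)-[\mathcal D(f+\eta)](\tau)|,\qquad Q_N^{L,\mathbf R}(t)=\sup_{f\in\mathcal F_L^{\mathbf R},\,\eta\in\mathcal E_N}\ \sup_{\tau\ge t}|[\mathcal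 Df](\tau)-[\mathcal D(f+\eta)](\tau)|.$$ $\mathcal D$ is *exact in finite time* over $\mathcal F_L$ if for every $\mathbf R$ there is $T>0$ with $M_0^{L,\mathbf R}(T)=0$; it is *exact in fixed time* if one $T>0$ works for all $\mathbf R$. It is *robust from the beginning* over $\mathcal F_L$ if $\limsup_{N\to0^+}Q_N^{L,\mathbf R}(0)=0$ for every $\mathbf R$. It has *accuracy bound $C$ for noise bounds less than $\overline N\in(0,\infty]$, with convergence time function $\hat{\mathcal T}$*, if $\hat{\mathcal T}:\mathbb R_{\ge0}^2\times[0,\overline N)\to\mathbb R_{\ge0}$ is continuous in its second argument and $M_N^{L,\mathbf R}(\hat{\mathcal T}(\mathbf R,N))\le C\sqrt{NL}$ for all $\mathbf R$ and all $N\in[0,\overline N)$. **The differentiator.** Let $L>0$, $\gamma>L$, $t_0\ge0$ and $\overline T\in(0,\infty]$. For $u\in\mathcal U$ put $Q(t,T,\sigma)=u(t-\sigma)-u(t)+\frac{u(t)-u(t-T)}{T}\sigma$, $$\hat N(t)=\frac12\sup_{\substack{0<T\le\overline T,\ T\le t\\ \sigma\in[0,T]}}\Bigl(|Q(t,T,\sigma)|-\frac{L\sigma(T-\sigma)}2\Bigr),\qquad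 \hat T(t)=\min\Bigl\{t,\overline T,2\sqrt{\hat N(t)/L}\Bigr\}.$$ Let $y_{\mathrm w}(0)=0$ and, for $t>0$, $y_{\mathrm w}(t)=\frac{u(t)-u(t-\hat T(t))}{\hat T(t)}$ if $\hat T(t)>0$ and $y_{\mathrm w}(t)=\lim_{T\to0^+}\frac{u(t)-u(t-T)}{T}$ if $\hat T(t)=0$. Let $y_{\mathrm m}(0)=y_{\mathrm w}(0)$ and $y_{\mathrm m}(t)=\frac12\bigl(\limsup_{\varepsilon\to0^+}y_{\mathrm w}(t-\varepsilon)+\liminf_{\varepsilon\to0^+}y_{\mathrm w}(t-\varepsilon)\bigr)$ for $t>0$. Finally $y=\mathcal Du$ is the Filippov solution on $[t_0,\infty)$ of $$\dot y(t)=-\gamma\,\mathrm{sign}(y(t)-y_{\mathrm m}(t)),\qquad y(t_0)=y_{\mathrm m}(t_0),$$ and $y(t)=0$ for $t\in[0,t_0)$. **Theorem.** For every $u\in\mathcal U$ this Filippov solution exists and is unique, and the operator $\mathcal D$ so defined is causal. Moreover, with $\overline N=L\overline T^2/2$: (a) for every $u\in\mathcal U$, $\mathcal Du$ is Lipschitz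 continuous with constant $\gamma$ on $[t_0,\infty)$ and on $[0,t_0)$; (b) if $t_0=0$, then $\mathcal D$ is exact in finite time over $\mathcal F_L$ and has accuracy bound $2\sqrt2$ for noise bounds less than $\overline N$, with convergence time function $$\hat{\mathcal T}(\mathbf R,N)=2\sqrt{\frac{2N}{L}}+\frac{R_1}{\gamma-L};$$ (c) if $t_0>0$, then $\mathcal D$ is exact in fixed time over $\mathcal F_L$ and has accuracy bound $2\sqrt2$ for noise bounds less than $\overline N$, with convergence time function $$\hat{\mathcal T}(\mathbf R,N)=\begin{cases}t_0,& N\le \frac{Lt_0^2}{2},\\[2pt] 2\sqrt{\frac{2N}{L}}+\dfrac{\frac{2N}{t_0}-\gamma t_0}{\gamma-L},&\text{otherwise};\end{cases}$$ (d) $\mathcal D$ is robust from the beginning over $\mathcal F_L$. -/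

import Mathlib

open Set Filter Topology MeasureTheory
open scoped ENNReal

namespace RobustDiff

noncomputable section

/-! Signals are functions of the time `t ≥ 0`. They are represented by functions `ℝ → ℝ` of which
only the values on `[0, ∞)` are ever used. -/

/-- The derivative of a signal on `[0, ∞)` (one-sided at `0`). -/
def sigDeriv (f : ℝ → ℝ) : ℝ → ℝ := fun t => derivWithin f (Ici 0) t

/-- Differentiable signals with a Lipschitz-continuous derivative on `[0, ∞)`. -/
def smoothSignals : Set (ℝ → ℝ) :=
  {f | DifferentiableOn ℝ f (Ici 0) ∧ ∃ K, LipschitzOnWith K (sigDeriv f) (Ici 0)}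

/-- The class `F_L`: the second derivative is bounded by `L` almost everywhere. -/
def signalClass (L : ℝ) : Set (ℝ → ℝ) :=
  {f | f ∈ smoothSignals ∧ ∀ᵐ t ∂(volume.restrict (Ici 0)), |sigDeriv (sigDeriv f) t| ≤ L}

/-- The class `F_L^R`, with `R = (R₀, R₁)`. -/
def signalClassInit (L R₀ R₁ : ℝ) : Set (ℝ → ℝ) :=
  {f | f ∈ signalClass L ∧ |f 0| ≤ R₀ ∧ |sigDeriv f 0| ≤ R₁}

/-- The class `E_N` of noises bounded by `N` (no measurability is required). -/
def noiseClass (N : ℝ) : Set (ℝ → ℝ) := {η | ∀ t, 0 ≤ t → |η t| ≤ N}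

/-- The set of all inputs: the union of all `F_L + E_N`. -/
def inputs : Set (ℝ → ℝ) :=
  {u | ∃ L N : ℝ, 0 ≤ L ∧ 0 ≤ N ∧ ∃ f ∈ signalClass L, ∃ η ∈ noiseClass N, u = f + η}

/-! ### Performance measures of an operator `D` from inputs to derivative estimates -/

/-- Causality: the output at time `t` depends only on the input on `[0, t]`. -/
def IsCausal (D : (ℝ → ℝ) → (ℝ → ℝ)) : Prop :=
  ∀ u ∈ inputs, ∀ v ∈ inputs, ∀ t : ℝ, 0 ≤ t → (∀ s ∈ Icc 0 t, u s = v s) → D u t = D v t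

/-- The worst-case error `M_N^{L,R}(t)`, possibly infinite. -/
def worstCaseError (D : (ℝ → ℝ) → (ℝ → ℝ)) (L R₀ R₁ N t : ℝ) : ℝ≥0∞ :=
  ⨆ f ∈ signalClassInit L R₀ R₁, ⨆ η ∈ noiseClass N, ⨆ τ ∈ Ici t,
    ENNReal.ofReal |sigDeriv f τ - D (f + η) τ|

/-- Exactness in finite time over `F_L`. -/
def ExactInFiniteTime (D : (ℝ → ℝ) → (ℝ → ℝ)) (L : ℝ) : Prop :=
  ∀ R₀ R₁ : ℝ, 0 ≤ R₀ → 0 ≤ R₁ → ∃ T : ℝ, 0 < T ∧ worstCaseError D L R₀ R₁ 0 T = 0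

/-- Exactness in fixed time over `F_L`. -/
def ExactInFixedTime (D : (ℝ → ℝ) → (ℝ → ℝ)) (L : ℝ) : Prop :=
  ∃ T : ℝ, 0 < T ∧ ∀ R₀ R₁ : ℝ, 0 ≤ R₀ → 0 ≤ R₁ → worstCaseError D L R₀ R₁ 0 T = 0

/-- The quantity `Q_N^{L,R}(t)`, possibly infinite. -/
def noiseEffect (D : (ℝ → ℝ) → (ℝ → ℝ)) (L R₀ R₁ N t : ℝ) : ℝ≥0∞ :=
  ⨆ f ∈ signalClassInit L R₀ R₁, ⨆ η ∈ noiseClass N, ⨆ τ ∈ Ici t,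
    ENNReal.ofReal |D f τ - D (f + η) τ|

/-- Robustness from the beginning over `F_L`. -/
def RobustFromBeginning (D : (ℝ → ℝ) → (ℝ → ℝ)) (L : ℝ) : Prop :=
  ∀ R₀ R₁ : ℝ, 0 ≤ R₀ → 0 ≤ R₁ →
    limsup (fun N : ℝ => noiseEffect D L R₀ R₁ N 0) (𝓝[>] 0) = 0

/-- `That R₀ R₁ N` is a convergence time function in the presence of noise for the accuracy
bound `C`, for signals in `F_L` with noise bounds less than `Nbar` (possibly `∞`). -/
def IsConvergenceTimeFunction (D : (ℝ → ℝ) → (ℝ → ℝ)) (L C : ℝ) (Nbar : ℝ≥0∞)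
    (That : ℝ → ℝ → ℝ → ℝ) : Prop :=
  ∀ R₀ R₁ : ℝ, 0 ≤ R₀ → 0 ≤ R₁ →
    ContinuousOn (That R₀ R₁) {N : ℝ | 0 ≤ N ∧ ENNReal.ofReal N < Nbar} ∧
    ∀ N : ℝ, 0 ≤ N → ENNReal.ofReal N < Nbar →
      0 ≤ That R₀ R₁ N ∧
      worstCaseError D L R₀ R₁ N (That R₀ R₁ N) ≤ ENNReal.ofReal (C * √(N * L))

/-- `D` has accuracy bound `C` for signals in `F_L` with noise bounds less than `Nbar`. -/
def HasAccuracyBound (D : (ℝ → ℝ) → (ℝ → ℝ)) (L C : ℝ) (Nbar : ℝ≥0∞) : Prop :=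
  ∃ That : ℝ → ℝ → ℝ → ℝ, IsConvergenceTimeFunction D L C Nbar That

/-! ### The optimal exact differentiator, with window length `Tbar ∈ (0, ∞]` -/

/-- `Q(t, T, σ)`. -/
def devQ (u : ℝ → ℝ) (t T σ : ℝ) : ℝ := u (t - σ) - u t + (u t - u (t - T)) / T * σ

/-- The noise amplitude estimate `N̂(t)`. For an input `u` the supremum is over a set that is
bounded above, and nonempty if `t > 0`. -/
def noiseEst (L : ℝ) (Tbar : ℝ≥0∞) (u : ℝ → ℝ) (t : ℝ) : ℝ :=
  1 / 2 * sSup {x : ℝ | ∃ T σ : ℝ, 0 < T ∧ ENNReal.ofReal T ≤ Tbar ∧ T ≤ t ∧ σ ∈ Icc 0 T ∧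
    x = |devQ u t T σ| - L * σ * (T - σ) / 2}

/-- The time difference `T̂(t) = min {t, Tbar, 2 √(N̂(t) / L)}`. -/
def timeDiff (L : ℝ) (Tbar : ℝ≥0∞) (u : ℝ → ℝ) (t : ℝ) : ℝ :=
  (min (min (ENNReal.ofReal t) Tbar)
    (ENNReal.ofReal (2 * √(noiseEst L Tbar u t / L)))).toReal

open Classical in
/-- The output `y_w` of the optimal exact differentiator. -/
def outW (L : ℝ) (Tbar : ℝ≥0∞) (u : ℝ → ℝ) (t : ℝ) : ℝ :=
  if t = 0 then 0
  else if timeDiff L Tbar u t = 0 then limUnder (𝓝[>] (0 : ℝ)) (fun T => (u t - u (t - T)) / T)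
  else (u t - u (t - timeDiff L Tbar u t)) / timeDiff L Tbar u t

open Classical in
/-- The regularization `v‡`, with values in the extended reals and `∞ + (-∞) := 0`. -/
def regularization (v : ℝ → ℝ) (t : ℝ) : EReal :=
  if t = 0 then (v 0 : EReal)
  else
    let a : EReal := limsup (fun ε : ℝ => (v (t - ε) : EReal)) (𝓝[>] 0)
    let b : EReal := liminf (fun ε : ℝ => (v (t - ε) : EReal)) (𝓝[>] 0)
    if a = ⊤ ∧ b = ⊥ then 0 else (a + b) / 2

/-- The output `y_m = y_w‡` of the regularized differentiator `D_m`. The regularization is finite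
for every input, since `y_w` is locally bounded on `(0, ∞)`. -/
def outM (L : ℝ) (Tbar : ℝ≥0∞) (u : ℝ → ℝ) (t : ℝ) : ℝ :=
  (regularization (outW L Tbar u) t).toReal

/-! ### The sliding-mode filter -/

/-- The Filippov set of `g : ℝ → ℝ` at `x`: the intersection, over all `δ > 0` and all Lebesgue
null sets `Z`, of the closed convex hulls of `g (B(x, δ) \ Z)`. -/
def filippovSet (g : ℝ → ℝ) (x : ℝ) : Set ℝ :=
  ⋂ (δ : ℝ) (_ : 0 < δ) (Z : Set ℝ) (_ : volume Z = 0),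
    closedConvexHull ℝ (g '' (Metric.ball x δ \ Z))

/-- `y` is a Filippov solution on `[t₀, ∞)` of `ẏ = g(t, y)`, `y(t₀) = y₀`: it is locally
absolutely continuous and satisfies the associated differential inclusion almost everywhere. -/
def IsFilippovSolution (g : ℝ → ℝ → ℝ) (t₀ y₀ : ℝ) (y : ℝ → ℝ) : Prop :=
  y t₀ = y₀ ∧ (∀ T, t₀ ≤ T → AbsolutelyContinuousOnInterval y t₀ T) ∧
    ∀ᵐ t ∂(volume.restrict (Ioi t₀)), ∃ d ∈ filippovSet (g t) (y t), HasDerivAt y d t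

/-- `y` is the output of the filter `ẏ = -γ sign (y - y_m)`, `y(t₀) = y_m(t₀)`, extended by `0`
to the times before `t₀`. -/
def IsFilterOutput (L : ℝ) (Tbar : ℝ≥0∞) (γ t₀ : ℝ) (u y : ℝ → ℝ) : Prop :=
  IsFilippovSolution (fun t x => -γ * Real.sign (x - outM L Tbar u t)) t₀ (outM L Tbar u t₀) y ∧
    ∀ t, t < t₀ → y t = 0

/-- The proposed differentiator `D`: it maps `u` to the (unique) filter output. -/
def filteredDiff (L : ℝ) (Tbar : ℝ≥0∞) (γ t₀ : ℝ) (u : ℝ → ℝ) : ℝ → ℝ :=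
  Classical.epsilon (IsFilterOutput L Tbar γ t₀ u)

end

end RobustDiff

open RobustDiff

namespace RobustDiff

/-! ### Increments of absolutely continuous functions -/

/-! Write h = √(2N/L) (`settlingTime`) and S = min(t, h). The proof joins an accuracy bound for
`y_m` with the dynamics of a relay.

Accuracy. Q(t, T, σ) is σ times the difference of the backward slopes over T and σ. A signal in F_L
contributes at most Lσ(T-σ)/2 to it and the noise at most 2N, so N̂ ≤ N. If T̂ ≤ S, the definition
of N̂ puts the slope over T̂ within LS/2 of the slope over S, which is itself within LS/2 + 2N/S of
f'. If T̂ > S, then S = h and the bound T̂ ≤ 2√(N/L) suffices. Either way `y_w` has error at most LS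
+ 2N/S (`abs_outW_sub_le`), which for t ≥ h is 2Lh = 2√2 √(NL). The regularization keeps the bound
and makes `y_m` measurable for every input.

Relay. The sign is monotone, so the gap between two solutions, exact or approximate, cannot grow
beyond the mismatch of their data (`relay_le_add`, `IsApproxSolution.sub_le`). This gives
uniqueness, causality, robustness, and existence as a limit of Euler polygons. Since f' moves at
rate at most L < γ, an error above the accuracy of `y_m` shrinks at rate at least γ - L
(`relay_tracking_le`). The convergence times follow by bounding the error at h, or at t₀ if t₀ ≥ h,
and dividing the excess over 2Lh by γ - L. -/

lemma sub_le_of_ae_deriv_le {g : ℝ → ℝ} {a b C : ℝ} (hab : a ≤ b)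
    (hg : AbsolutelyContinuousOnInterval g a b)
    (h : ∀ᵐ t, t ∈ Ioo a b → deriv g t ≤ C) : g b - g a ≤ C * (b - a) := by
  rw [← hg.integral_deriv_eq_sub]
  have h1 : ∫ t in a..b, deriv g t ≤ ∫ _ in a..b, C := by
    refine intervalIntegral.integral_mono_ae_restrict hab hg.intervalIntegrable_deriv
      intervalIntegrable_const ?_
    rw [restrict_Ioo_eq_restrict_Icc.symm]
    exact (ae_restrict_iff' measurableSet_Ioo).2 h
  refine h1.trans (le_of_eq ?_)
  rw [intervalIntegral.integral_const, smul_eq_mul, mul_comm]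

lemma abs_sub_le_of_ae_abs_deriv_le {g : ℝ → ℝ} {a b C : ℝ} (hab : a ≤ b)
    (hg : AbsolutelyContinuousOnInterval g a b)
    (h : ∀ᵐ t, t ∈ Ioo a b → |deriv g t| ≤ C) : |g b - g a| ≤ C * (b - a) := by
  rw [abs_le]
  constructor
  · have := sub_le_of_ae_deriv_le hab hg.neg (C := C) (by
      filter_upwards [h] with t ht hm
      rw [deriv.neg]
      linarith [(abs_le.1 (ht hm)).1])
    simp only [Pi.neg_apply] at this
    linarith
  · exact sub_le_of_ae_deriv_le hab hg (by
      filter_upwards [h] with t ht hm using (abs_le.1 (ht hm)).2)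

lemma exists_last_le {z : ℝ → ℝ} {a b c : ℝ} (hab : a ≤ b) (hz : ContinuousOn z (Icc a b))
    (ha : z a ≤ c) (hb : c < z b) : ∃ s ∈ Ico a b, z s ≤ c ∧ ∀ r ∈ Ioc s b, c < z r := by
  have hcpt : IsCompact (Icc a b ∩ z ⁻¹' Iic c) := by
    refine IsCompact.of_isClosed_subset isCompact_Icc ?_ inter_subset_left
    exact hz.preimage_isClosed_of_isClosed isClosed_Icc isClosed_Iic
  obtain ⟨s, ⟨hs, hsc⟩, hmax⟩ := hcpt.exists_isGreatest ⟨a, ⟨le_rfl, hab⟩, ha⟩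
  have hsc' : z s ≤ c := hsc
  have hsb : s ≠ b := fun h => by rw [h] at hsc'; linarith
  refine ⟨s, ⟨hs.1, lt_of_le_of_ne hs.2 hsb⟩, hsc', fun r hr => ?_⟩
  by_contra! hle
  exact absurd (hmax ⟨⟨hs.1.trans hr.1.le, hr.2⟩, hle⟩) (not_le.2 hr.1)

/-- Barrier principle: start from the last time at which z is at most c. Only the behaviour of z
above the level matters, which suits a discontinuous right-hand side. -/
lemma le_of_sub_le_above {z : ℝ → ℝ} {a b c : ℝ} (hab : a ≤ b) (hz : ContinuousOn z (Icc a b))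
    (ha : z a ≤ c)
    (h : ∀ s ∈ Ico a b, (∀ r ∈ Ioc s b, c < z r) → z b - z s ≤ 0) : z b ≤ c := by
  by_contra! hb
  obtain ⟨s, hs, hsc, hr⟩ := exists_last_le hab hz ha hb
  linarith [h s hs hr]

/-! ### The Filippov set of a relay -/

lemma abs_sign_le_one (x : ℝ) : |Real.sign x| ≤ 1 := by
  unfold Real.sign
  split_ifs <;> simp

lemma sign_mono : Monotone Real.sign := by
  intro a b hab
  unfold Real.sign
  split_ifs <;> linarith

/-- Off the switching point the relay is constant on a small ball. At that point, deleting a null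
set leaves points on both sides, so the hull is all of [-γ, γ]. -/
lemma mem_filippovSet_relay {γ m x d : ℝ} (hγ : 0 < γ) :
    d ∈ filippovSet (fun x => -γ * Real.sign (x - m)) x ↔
      |d| ≤ γ ∧ (m < x → d = -γ) ∧ (x < m → d = γ) := by
  simp only [filippovSet, mem_iInter]
  constructor
  · intro h
    refine ⟨?_, fun hx => ?_, fun hx => ?_⟩
    · have := closedConvexHull_min (t := Icc (-γ) γ) ?_ (convex_Icc _ _) isClosed_Icc
        (h 1 one_pos ∅ (by simp))
      · exact abs_le.2 this
      · rintro _ ⟨z, -, rfl⟩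
        have := abs_le.1 (abs_sign_le_one (z - m))
        constructor <;> nlinarith
    · have := closedConvexHull_min (t := {-γ}) ?_ (convex_singleton _) isClosed_singleton
        (h (x - m) (sub_pos.2 hx) ∅ (by simp))
      · exact this
      · rintro _ ⟨z, ⟨hz, -⟩, rfl⟩
        rw [Metric.mem_ball, Real.dist_eq, abs_lt] at hz
        have : Real.sign (z - m) = 1 := Real.sign_of_pos (by linarith)
        simp [this]
    · have := closedConvexHull_min (t := {γ}) ?_ (convex_singleton _) isClosed_singleton
        (h (m - x) (sub_pos.2 hx) ∅ (by simp))
      · exact this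
      · rintro _ ⟨z, ⟨hz, -⟩, rfl⟩
        rw [Metric.mem_ball, Real.dist_eq, abs_lt] at hz
        have : Real.sign (z - m) = -1 := Real.sign_of_neg (by linarith)
        simp [this]
  · rintro ⟨hd, h1, h2⟩ δ hδ Z hZ
    have key : ∀ a b : ℝ, a < b → ∃ z ∈ Ioo a b, z ∉ Z := by
      intro a b hab
      by_contra! hsub
      have := measure_mono_null (show Ioo a b ⊆ Z from hsub) hZ
      simp only [Real.volume_Ioo, ENNReal.ofReal_eq_zero] at this
      linarith
    have right : m ≤ x →
        -γ ∈ closedConvexHull ℝ ((fun x => -γ * Real.sign (x - m)) '' (Metric.ball x δ \ Z)) := by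
      intro hx
      obtain ⟨z, hz, hzZ⟩ := key x (x + δ) (by linarith)
      refine subset_closedConvexHull ⟨z, ⟨?_, hzZ⟩, ?_⟩
      · rw [Metric.mem_ball, Real.dist_eq, abs_lt]
        constructor <;> linarith [hz.1, hz.2]
      · have : Real.sign (z - m) = 1 := Real.sign_of_pos (by linarith [hz.1])
        simp [this]
    have left : x ≤ m →
        γ ∈ closedConvexHull ℝ ((fun x => -γ * Real.sign (x - m)) '' (Metric.ball x δ \ Z)) := by
      intro hx
      obtain ⟨z, hz, hzZ⟩ := key (x - δ) x (by linarith)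
      refine subset_closedConvexHull ⟨z, ⟨?_, hzZ⟩, ?_⟩
      · rw [Metric.mem_ball, Real.dist_eq, abs_lt]
        constructor <;> linarith [hz.1, hz.2]
      · have : Real.sign (z - m) = -1 := Real.sign_of_neg (by linarith [hz.2])
        simp [this]
    rcases lt_trichotomy m x with hx | hx | hx
    · rw [h1 hx]; exact right hx.le
    · have hseg := (convex_closedConvexHull (𝕜 := ℝ)).segment_subset (right hx.le) (left hx.ge)
      rw [segment_eq_Icc (by linarith)] at hseg
      exact hseg (abs_le.1 hd)
    · rw [h2 hx]; exact left hx.le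

/-! ### Filippov solutions of the relay equation `ẏ = -γ sign (y - m)` -/

/-- The relay equation tracking the function `m`. -/
noncomputable def relay (γ : ℝ) (m : ℝ → ℝ) : ℝ → ℝ → ℝ := fun t x => -γ * Real.sign (x - m t)

lemma uIcc_subset_Ici {t₀ s t : ℝ} (hs : t₀ ≤ s) (ht : t₀ ≤ t) : uIcc s t ⊆ Ici t₀ :=
  fun _ hr => (le_min hs ht).trans hr.1

lemma IsFilippovSolution.absolutelyContinuous {g : ℝ → ℝ → ℝ} {t₀ y₀ s t : ℝ} {y : ℝ → ℝ}
    (h : IsFilippovSolution g t₀ y₀ y) (hs : t₀ ≤ s) (ht : s ≤ t) :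
    AbsolutelyContinuousOnInterval y s t := by
  refine (h.2.1 t (hs.trans ht)).mono ?_
  rw [uIcc_of_le ht, uIcc_of_le (hs.trans ht)]
  exact Icc_subset_Icc_left hs

lemma lipschitzOnWith_Ici_of_sub_le {γ t₀ : ℝ} {y : ℝ → ℝ}
    (h : ∀ s t, t₀ ≤ s → s ≤ t → |y t - y s| ≤ γ * (t - s)) :
    LipschitzOnWith γ.toNNReal y (Ici t₀) := by
  refine LipschitzOnWith.of_dist_le' fun s hs t ht => ?_
  rw [Real.dist_eq, Real.dist_eq]
  rcases le_total s t with hst | hst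
  · rw [abs_sub_comm, abs_sub_comm s, abs_of_nonneg (sub_nonneg.2 hst)]
    exact h s t hs hst
  · rw [abs_of_nonneg (sub_nonneg.2 hst)]
    exact h t s ht hst

lemma abs_sub_le_of_lipschitzOnWith {γ : ℝ} (hγ : 0 ≤ γ) {y : ℝ → ℝ} {S : Set ℝ}
    (h : LipschitzOnWith γ.toNNReal y S) {s t : ℝ} (hs : s ∈ S) (ht : t ∈ S) :
    |y t - y s| ≤ γ * |t - s| := by
  have := h.dist_le_mul t ht s hs
  rwa [Real.dist_eq, Real.dist_eq, Real.coe_toNNReal _ hγ] at this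

/-- On the set y = m the inclusion only asks for a slope of size at most γ, and the Lipschitz
condition already gives this wherever y is differentiable, hence almost everywhere. -/
theorem isFilippovSolution_relay_iff {γ t₀ y₀ : ℝ} (hγ : 0 < γ) {m y : ℝ → ℝ} :
    IsFilippovSolution (relay γ m) t₀ y₀ y ↔ y t₀ = y₀ ∧
      LipschitzOnWith γ.toNNReal y (Ici t₀) ∧
      ∀ᵐ t, t₀ < t → (m t < y t → HasDerivAt y (-γ) t) ∧ (y t < m t → HasDerivAt y γ t) := by
  constructor
  · intro h
    have hae := (ae_restrict_iff' measurableSet_Ioi).1 h.2.2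
    refine ⟨h.1, lipschitzOnWith_Ici_of_sub_le fun s t hs hst => ?_, ?_⟩
    · refine abs_sub_le_of_ae_abs_deriv_le hst (h.absolutelyContinuous hs hst) ?_
      filter_upwards [hae] with r hr hrm
      obtain ⟨d, hd, hder⟩ := hr (lt_of_le_of_lt hs hrm.1)
      rw [hder.deriv]
      exact ((mem_filippovSet_relay hγ).1 hd).1
    · filter_upwards [hae] with t ht htt
      obtain ⟨d, hd, hder⟩ := ht htt
      obtain ⟨-, h1, h2⟩ := (mem_filippovSet_relay hγ).1 hd
      exact ⟨fun h => h1 h ▸ hder, fun h => h2 h ▸ hder⟩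
  · rintro ⟨h0, hl, hae⟩
    refine ⟨h0, fun T hT => (hl.mono (uIcc_subset_Ici le_rfl hT)).absolutelyContinuousOnInterval,
      ?_⟩
    rw [ae_restrict_iff' measurableSet_Ioi]
    have hdiff := (ae_restrict_iff' measurableSet_Ici).1
      (hl.ae_differentiableWithinAt (μ := volume) measurableSet_Ici)
    filter_upwards [hae, hdiff] with t ht hdt htt
    have hn : Ici t₀ ∈ 𝓝 t := Ici_mem_nhds htt
    have hd : HasDerivAt y (deriv y t) t :=
      ((hdt (mem_Ici.2 htt.le)).differentiableAt hn).hasDerivAt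
    refine ⟨deriv y t, (mem_filippovSet_relay hγ).2 ⟨?_, fun h => ?_, fun h => ?_⟩, hd⟩
    · have := norm_deriv_le_of_lipschitzOn hn hl
      rwa [Real.norm_eq_abs, Real.coe_toNNReal _ hγ.le] at this
    · exact ((ht htt).1 h).deriv
    · exact ((ht htt).2 h).deriv

/-- The sign is odd; this symmetry turns one-sided estimates into two-sided ones. -/
lemma IsFilippovSolution.relay_neg {γ t₀ y₀ : ℝ} (hγ : 0 < γ) {m y : ℝ → ℝ}
    (h : IsFilippovSolution (relay γ m) t₀ y₀ y) :
    IsFilippovSolution (relay γ (-m)) t₀ (-y₀) (-y) := by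
  rw [isFilippovSolution_relay_iff hγ] at h ⊢
  obtain ⟨h0, hl, hae⟩ := h
  refine ⟨by simp [h0], hl.neg, ?_⟩
  filter_upwards [hae] with t ht htt
  refine ⟨fun h => ?_, fun h => ?_⟩
  · exact ((ht htt).2 (by simpa using h)).neg
  · simpa using ((ht htt).1 (by simpa using h)).neg

lemma IsFilippovSolution.relay_sub_le {γ t₀ y₀ : ℝ} (hγ : 0 < γ) {m y : ℝ → ℝ}
    (h : IsFilippovSolution (relay γ m) t₀ y₀ y) {s t : ℝ} (hs : t₀ ≤ s) (hst : s ≤ t)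
    (hm : ∀ r ∈ Ioo s t, m r < y r) : y t - y s ≤ -γ * (t - s) := by
  refine sub_le_of_ae_deriv_le hst (h.absolutelyContinuous hs hst) ?_
  filter_upwards [((isFilippovSolution_relay_iff hγ).1 h).2.2] with r hr hrm
  exact ((hr (lt_of_le_of_lt hs hrm.1)).1 (hm r hrm)).deriv.le

/-- Comparison of two solutions tracking different functions. -/
theorem IsFilippovSolution.relay_le_add {γ t₀ y₁ y₂ : ℝ} (hγ : 0 < γ) {m n y z : ℝ → ℝ}
    (hy : IsFilippovSolution (relay γ m) t₀ y₁ y) (hz : IsFilippovSolution (relay γ n) t₀ y₂ z)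
    {a b c : ℝ} (ha : t₀ ≤ a) (hab : a ≤ b) (hmn : ∀ t ∈ Ioo a b, m t ≤ n t + c)
    (h : y a ≤ z a + c) : y b ≤ z b + c := by
  obtain ⟨-, hyl, hyd⟩ := (isFilippovSolution_relay_iff hγ).1 hy
  obtain ⟨-, hzl, hzd⟩ := (isFilippovSolution_relay_iff hγ).1 hz
  have hyf := (ae_restrict_iff' measurableSet_Ioi).1 hy.2.2
  have hzf := (ae_restrict_iff' measurableSet_Ioi).1 hz.2.2
  have hsub : Icc a b ⊆ Ici t₀ := fun r hr => ha.trans hr.1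
  suffices (y - z) b ≤ c by simp only [Pi.sub_apply] at this; linarith
  refine le_of_sub_le_above hab ((hyl.continuousOn.mono hsub).sub (hzl.continuousOn.mono hsub))
    (by simp only [Pi.sub_apply]; linarith) fun s hs hr => ?_
  have has := ha.trans hs.1
  have := sub_le_of_ae_deriv_le (C := 0) hs.2.le
    ((hy.absolutelyContinuous has hs.2.le).sub (hz.absolutelyContinuous has hs.2.le)) ?_
  · linarith
  filter_upwards [hyf, hzf] with r hyr hzr hrm
  have hr0 : t₀ < r := lt_of_le_of_lt has hrm.1
  obtain ⟨d, hd, hyd⟩ := hyr hr0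
  obtain ⟨e, he, hze⟩ := hzr hr0
  rw [(hyd.sub hze).deriv]
  have h1 := hr r ⟨hrm.1, hrm.2.le⟩
  have h2 := hmn r ⟨lt_of_le_of_lt hs.1 hrm.1, hrm.2⟩
  simp only [Pi.sub_apply] at h1
  obtain ⟨hd0, hd1, -⟩ := (mem_filippovSet_relay hγ).1 hd
  obtain ⟨he0, -, he2⟩ := (mem_filippovSet_relay hγ).1 he
  rw [abs_le] at hd0 he0
  -- If z < n, then z rises at the maximal rate γ. Otherwise y > z + c ≥ n + c ≥ m, and y falls at
  -- the maximal rate. In both cases y - z does not increase.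
  rcases lt_or_ge (z r) (n r) with hzn | hzn
  · linarith [he2 hzn]
  · linarith [hd1 (by linarith)]

lemma IsFilippovSolution.relay_eq {γ t₀ y₀ : ℝ} (hγ : 0 < γ) {m n y z : ℝ → ℝ}
    (hy : IsFilippovSolution (relay γ m) t₀ y₀ y) (hz : IsFilippovSolution (relay γ n) t₀ y₀ z)
    {b : ℝ} (hb : t₀ ≤ b) (hmn : ∀ t ∈ Ioo t₀ b, m t = n t) : y b = z b := by
  apply le_antisymm
  · simpa using hy.relay_le_add hγ hz (c := 0) le_rfl hb (fun t ht => by simp [hmn t ht])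
      (by simp [hy.1, hz.1])
  · simpa using hz.relay_le_add hγ hy (c := 0) le_rfl hb (fun t ht => by simp [hmn t ht])
      (by simp [hy.1, hz.1])

/-! ### Existence of solutions by the Euler scheme -/

lemma measurable_sign : Measurable Real.sign := sign_mono.measurable

lemma intervalIntegrable_of_abs_le {r : ℝ → ℝ} {C : ℝ} (hr : Measurable r)
    (hC : ∀ t, |r t| ≤ C) (a b : ℝ) : IntervalIntegrable r volume a b :=
  (intervalIntegrable_const (c := C)).mono_fun hr.aestronglyMeasurable
    (Eventually.of_forall fun t => by
      simpa [Real.norm_eq_abs] using (hC t).trans (le_abs_self C))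

lemma abs_relay_le {γ : ℝ} (hγ : 0 < γ) (m : ℝ → ℝ) (t x : ℝ) : |relay γ m t x| ≤ γ := by
  rw [relay, abs_mul, abs_neg, abs_of_pos hγ]
  exact mul_le_of_le_one_right hγ.le (abs_sign_le_one _)

lemma measurable_relay (γ : ℝ) {m v : ℝ → ℝ} (hm : Measurable m) (hv : Measurable v) :
    Measurable fun t => relay γ m t (v t) :=
  (measurable_sign.comp (hv.sub hm)).const_mul _

/-- The nodes of the Euler scheme with exact integration in time. -/
noncomputable def eulerNode (g : ℝ → ℝ → ℝ) (t₀ y₀ h : ℝ) : ℕ → ℝ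
  | 0 => y₀
  | k + 1 => eulerNode g t₀ y₀ h k +
      ∫ s in (t₀ + k * h)..(t₀ + (k + 1) * h), g s (eulerNode g t₀ y₀ h k)

/-- `y` is an approximate solution of the relay equation with slope `r`, where the relay acts on a
value within `ε` of `y`. -/
structure IsApproxSolution (γ : ℝ) (m : ℝ → ℝ) (t₀ y₀ ε : ℝ) (y r : ℝ → ℝ) : Prop where
  init : y t₀ = y₀
  measurable : Measurable r
  abs_le : ∀ t, |r t| ≤ γ
  sub_eq : ∀ s t, y t - y s = ∫ τ in s..t, r τ
  slope : ∀ t, t₀ ≤ t → ∃ v, |v - y t| ≤ ε ∧ r t = relay γ m t v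

lemma abs_sub_le_of_eq_integral {γ : ℝ} {y r : ℝ → ℝ} (hr : ∀ t, |r t| ≤ γ)
    (h : ∀ s t, y t - y s = ∫ τ in s..t, r τ) (s t : ℝ) : |y t - y s| ≤ γ * |t - s| := by
  rw [h]
  exact intervalIntegral.norm_integral_le_of_norm_le_const (C := γ) (f := r) fun τ _ => hr τ

/-- Only the state is frozen on each step, and it moves by at most γh there. Time is integrated
exactly, because sampling a merely measurable m would carry no information. -/
lemma exists_isApproxSolution {γ : ℝ} (hγ : 0 < γ) {m : ℝ → ℝ} (hm : Measurable m) (t₀ y₀ : ℝ)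
    {h : ℝ} (hh : 0 < h) : ∃ y r, IsApproxSolution γ m t₀ y₀ (γ * h) y r := by
  set a := eulerNode (relay γ m) t₀ y₀ h with ha
  set r : ℝ → ℝ := fun t => relay γ m t (a ⌊(t - t₀) / h⌋₊) with hr
  have hrm : Measurable r := by
    refine measurable_relay γ hm ?_
    exact (measurable_from_nat (f := a)).comp
      (Nat.measurable_floor.comp ((measurable_id.sub_const t₀).div_const h))
  have hrb : ∀ t, |r t| ≤ γ := fun t => abs_relay_le hγ m t _
  have hri := intervalIntegrable_of_abs_le hrm hrb
  set y : ℝ → ℝ := fun t => y₀ + ∫ τ in t₀..t, r τ with hy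
  have hsub : ∀ s t, y t - y s = ∫ τ in s..t, r τ := fun s t => by
    have := intervalIntegral.integral_add_adjacent_intervals (hri t₀ s) (hri s t)
    simp only [hy]
    linarith
  have hnode : ∀ k : ℕ, y (t₀ + k * h) = a k := by
    intro k
    induction k with
    | zero => simp [hy, ha, eulerNode]
    | succ k ih =>
      have h1 := hsub (t₀ + k * h) (t₀ + (k + 1) * h)
      have h2 : ∫ τ in (t₀ + k * h)..(t₀ + (k + 1) * h), r τ =
          ∫ τ in (t₀ + k * h)..(t₀ + (k + 1) * h), relay γ m τ (a k) := by
        -- The right endpoint already has floor k + 1, so the integrands are compared on the open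
        -- interval.
        refine intervalIntegral.integral_congr_Ioo_of_le (by nlinarith) fun τ hτ => ?_
        have hf : ⌊(τ - t₀) / h⌋₊ = k := by
          rw [Nat.floor_eq_iff (div_nonneg (by nlinarith [hτ.1, k.cast_nonneg (α := ℝ)]) hh.le)]
          rw [le_div_iff₀ hh, div_lt_iff₀ hh]
          constructor <;> linarith [hτ.1, hτ.2]
        simp only [hr, hf]
      have h3 : a (k + 1) = a k + ∫ τ in (t₀ + k * h)..(t₀ + (k + 1) * h), relay γ m τ (a k) := rfl
      rw [h3, ← h2, ← h1, ← ih]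
      push_cast
      ring
  refine ⟨y, r, by simp [hy], hrm, hrb, hsub, fun t ht => ⟨a ⌊(t - t₀) / h⌋₊, ?_, rfl⟩⟩
  have hq : 0 ≤ (t - t₀) / h := div_nonneg (sub_nonneg.2 ht) hh.le
  have hl := abs_sub_le_of_eq_integral hrb hsub t (t₀ + ⌊(t - t₀) / h⌋₊ * h)
  rw [hnode] at hl
  refine hl.trans (mul_le_mul_of_nonneg_left ?_ hγ.le)
  have h1 := (le_div_iff₀ hh).1 (Nat.floor_le hq)
  have h2 := (div_lt_iff₀ hh).1 (Nat.lt_floor_add_one ((t - t₀) / h))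
  rw [abs_le]
  constructor <;> nlinarith

lemma IsApproxSolution.neg {γ t₀ y₀ ε : ℝ} {m y r : ℝ → ℝ}
    (h : IsApproxSolution γ m t₀ y₀ ε y r) :
    IsApproxSolution γ (-m) t₀ (-y₀) ε (-y) (-r) where
  init := by simp [h.init]
  measurable := h.measurable.neg
  abs_le t := by simpa using h.abs_le t
  sub_eq s t := by
    simp only [Pi.neg_apply, intervalIntegral.integral_neg, ← h.sub_eq]
    ring
  slope t ht := by
    obtain ⟨v, hv, hr⟩ := h.slope t ht
    refine ⟨-v, ?_, ?_⟩
    · rw [Pi.neg_apply, ← neg_sub', abs_neg]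
      exact hv
    · simp only [Pi.neg_apply, hr, relay, ← neg_sub', Real.sign_neg]
      ring

lemma IsApproxSolution.continuous {γ t₀ y₀ ε : ℝ} {m y r : ℝ → ℝ}
    (h : IsApproxSolution γ m t₀ y₀ ε y r) : Continuous y :=
  (LipschitzWith.of_dist_le' (K := γ) fun s t => by
    simpa [Real.dist_eq] using abs_sub_le_of_eq_integral h.abs_le h.sub_eq t s).continuous

/-- Once the gap exceeds ε + ε', the values fed to the two relays are ordered like the solutions,
and monotonicity of the sign stops the gap from growing. The Euler polygons are therefore uniformly
Cauchy, and no compactness is needed. -/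
lemma IsApproxSolution.sub_le {γ t₀ y₀ ε ε' : ℝ} (hγ : 0 < γ) (hε : 0 ≤ ε) (hε' : 0 ≤ ε')
    {m y r y' r' : ℝ → ℝ}
    (h : IsApproxSolution γ m t₀ y₀ ε y r) (h' : IsApproxSolution γ m t₀ y₀ ε' y' r')
    {t : ℝ} (ht : t₀ ≤ t) : y t - y' t ≤ ε + ε' := by
  refine le_of_sub_le_above (z := y - y') ht (h.continuous.sub h'.continuous).continuousOn
    (by simp [h.init, h'.init, add_nonneg hε hε']) fun s hs hgt => ?_
  have h1 : ∫ τ in s..t, r τ ≤ ∫ τ in s..t, r' τ := by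
    refine intervalIntegral.integral_mono_on_of_le_Ioo hs.2.le
      (intervalIntegrable_of_abs_le h.measurable h.abs_le _ _)
      (intervalIntegrable_of_abs_le h'.measurable h'.abs_le _ _) fun τ hτ => ?_
    obtain ⟨v, hv, hr⟩ := h.slope τ (hs.1.trans hτ.1.le)
    obtain ⟨v', hv', hr'⟩ := h'.slope τ (hs.1.trans hτ.1.le)
    have h2 := hgt τ ⟨hτ.1, hτ.2.le⟩
    simp only [Pi.sub_apply] at h2
    rw [_root_.abs_le] at hv hv'
    rw [hr, hr', relay, relay]
    have := sign_mono (show v' - m τ ≤ v - m τ by linarith)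
    nlinarith
  have h2 := h.sub_eq s t
  have h3 := h'.sub_eq s t
  simp only [Pi.sub_apply]
  linarith

/-- A limit of approximate solutions falls at the full rate wherever it is above `m`. -/
lemma deriv_le_of_tendsto_approx {γ t₀ y₀ : ℝ} (hγ : 0 < γ) {m Y : ℝ → ℝ} (hm : Measurable m)
    (hY : Measurable Y) {ε : ℕ → ℝ} (hε : Tendsto ε atTop (𝓝 0)) {y r : ℕ → ℝ → ℝ}
    (h : ∀ n, IsApproxSolution γ m t₀ y₀ (ε n) (y n) (r n))
    (hlim : ∀ n t, t₀ ≤ t → |y n t - Y t| ≤ ε n) :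
    ∀ᵐ t, t₀ < t → m t < Y t → DifferentiableAt ℝ Y t → deriv Y t ≤ -γ := by
  classical
  set φ : ℝ → ℝ := fun t => if m t < Y t then -γ else γ with hφ
  have hφm : Measurable φ :=
    Measurable.ite (measurableSet_lt hm hY) measurable_const measurable_const
  have hφb : ∀ t, |φ t| ≤ γ := fun t => by
    simp only [hφ]; split_ifs <;> simp [abs_of_pos hγ]
  have hφi := intervalIntegrable_of_abs_le hφm hφb
  have htend : ∀ t, t₀ ≤ t → Tendsto (fun n => y n t) atTop (𝓝 (Y t)) := fun t ht =>
    tendsto_iff_dist_tendsto_zero.2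
      (squeeze_zero (fun _ => dist_nonneg) (fun n => hlim n t ht) hε)
  have hinc : ∀ s t, t₀ ≤ s → s ≤ t → Y t - Y s ≤ ∫ τ in s..t, φ τ := by
    intro s t hs hst
    -- The relay acts on a value within ε of y n, hence within 2ε of Y; the margin 2ε guarantees
    -- that this value lies above m.
    set ψ : ℕ → ℝ → ℝ := fun n t => if m t + 2 * ε n < Y t then -γ else γ with hψ
    have hψm : ∀ n, Measurable (ψ n) := fun n =>
      Measurable.ite (measurableSet_lt (hm.add_const _) hY) measurable_const measurable_const
    have hψb : ∀ n t, |ψ n t| ≤ γ := fun n t => by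
      simp only [hψ]; split_ifs <;> simp [abs_of_pos hγ]
    have hlimψ : Tendsto (fun n => ∫ τ in s..t, ψ n τ) atTop (𝓝 (∫ τ in s..t, φ τ)) := by
      refine intervalIntegral.tendsto_integral_filter_of_dominated_convergence (fun _ => γ)
        (Eventually.of_forall fun n => (hψm n).aestronglyMeasurable)
        (Eventually.of_forall fun n => ae_of_all _ fun τ _ => hψb n τ)
        intervalIntegrable_const (ae_of_all _ fun τ hτ => ?_)
      refine tendsto_const_nhds.congr' ?_
      have hτ0 : t₀ ≤ τ := by
        rw [uIoc_of_le hst] at hτ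
        exact hs.trans hτ.1.le
      by_cases hlt : m τ < Y τ
      · have : ∀ᶠ n in atTop, ε n < (Y τ - m τ) / 2 := hε.eventually_lt_const (by linarith)
        filter_upwards [this] with n hn
        simp only [hφ, hψ, if_pos hlt]
        rw [if_pos (by linarith)]
      · refine Eventually.of_forall fun n => ?_
        have : 0 ≤ ε n := (abs_nonneg _).trans (hlim n τ hτ0)
        simp only [hφ, hψ, if_neg hlt]
        rw [if_neg (by linarith)]
    refine le_of_tendsto_of_tendsto ((htend t (hs.trans hst)).sub (htend s hs)) hlimψ
      (Eventually.of_forall fun n => ?_)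
    change y n t - y n s ≤ _
    rw [(h n).sub_eq]
    refine intervalIntegral.integral_mono_on_of_le_Ioo hst
      (intervalIntegrable_of_abs_le (h n).measurable (h n).abs_le _ _)
      (intervalIntegrable_of_abs_le (hψm n) (hψb n) _ _) fun τ hτ => ?_
    have hτ0 := hs.trans hτ.1.le
    simp only [hψ]
    split_ifs with hlt
    · obtain ⟨v, hv, hr⟩ := (h n).slope τ hτ0
      have h2 := hlim n τ hτ0
      rw [abs_le] at hv h2
      rw [hr, relay, Real.sign_of_pos (by linarith), mul_one]
    · exact (abs_le.1 ((h n).abs_le τ)).2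
  have hloc : LocallyIntegrable φ volume := by
    refine (locallyIntegrable_const (μ := volume) γ).mono hφm.aestronglyMeasurable
      (Eventually.of_forall fun t => ?_)
    simpa [Real.norm_eq_abs, abs_of_pos hγ] using hφb t
  filter_upwards [LocallyIntegrable.ae_hasDerivAt_integral hloc] with t ht htt hlt hd
  -- The integral of φ minus Y is nondecreasing by `hinc`; its derivative at a Lebesgue point is φ -
  -- Y', so this is nonnegative.
  have hder := (ht t₀).sub hd.hasDerivAt
  have hnn : 0 ≤ φ t - deriv Y t := by
    refine ge_of_tendsto (hasDerivAt_iff_tendsto_slope.1 hder |>.mono_left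
      (nhdsWithin_mono t (fun x (hx : x ∈ Ioi t) => ne_of_gt hx))) ?_
    filter_upwards [self_mem_nhdsWithin] with x hx
    have hx' : t < x := hx
    rw [slope_def_field]
    refine div_nonneg ?_ (sub_nonneg.2 hx'.le)
    have h1 := hinc t x htt.le hx'.le
    have h2 := intervalIntegral.integral_add_adjacent_intervals (hφi t₀ t) (hφi t x)
    simp only [Pi.sub_apply]
    linarith
  simp only [hφ, if_pos hlt] at hnn
  linarith

/-- The relay equation has a solution for every measurable `m`. -/
theorem exists_isFilippovSolution_relay {γ : ℝ} (hγ : 0 < γ) {m : ℝ → ℝ} (hm : Measurable m)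
    (t₀ y₀ : ℝ) :
    ∃ y, IsFilippovSolution (relay γ m) t₀ y₀ y ∧ ∀ t, t < t₀ → y t = 0 := by
  classical
  set δ : ℕ → ℝ := fun n => γ * (1 / ((n : ℝ) + 1)) with hδ
  have hδ0 : ∀ n, 0 ≤ δ n := fun n => by positivity
  have hδlim : Tendsto δ atTop (𝓝 0) := by
    simpa only [hδ, mul_zero] using
      (tendsto_one_div_add_atTop_nhds_zero_nat (𝕜 := ℝ)).const_mul γ
  have hex : ∀ n : ℕ, ∃ y r, IsApproxSolution γ m t₀ y₀ (δ n) y r := fun n =>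
    exists_isApproxSolution hγ hm t₀ y₀ (by positivity)
  choose y r hyr using hex
  have hdist : ∀ k n t, t₀ ≤ t → |y k t - y n t| ≤ δ k + δ n := fun k n t ht => by
    rw [abs_le]
    constructor
    · linarith [(hyr n).sub_le hγ (hδ0 n) (hδ0 k) (hyr k) ht]
    · exact (hyr k).sub_le hγ (hδ0 k) (hδ0 n) (hyr n) ht
  have hanti : Antitone δ := fun a b hab => by
    simp only [hδ]
    gcongr
  have hconv : ∀ t, t₀ ≤ t → ∃ l, Tendsto (fun n => y n t) atTop (𝓝 l) := fun t ht => by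
    refine cauchySeq_tendsto_of_complete
      (cauchySeq_of_le_tendsto_0 (fun n => 2 * δ n) (fun k n N hk hn => ?_) (by
        simpa using hδlim.const_mul 2))
    rw [Real.dist_eq]
    linarith [hdist k n t ht, hanti hk, hanti hn]
  choose! Y₀ hY₀ using hconv
  set Y : ℝ → ℝ := fun t => if t < t₀ then 0 else Y₀ t with hY
  have hYlim : ∀ t, t₀ ≤ t → Tendsto (fun n => y n t) atTop (𝓝 (Y t)) := fun t ht => by
    simpa only [hY, if_neg (not_lt.2 ht)] using hY₀ t ht
  have herr : ∀ n t, t₀ ≤ t → |y n t - Y t| ≤ δ n := fun n t ht => by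
    have h1 := (tendsto_const_nhds (x := y n t)).sub (hYlim t ht) |>.abs
    have h2 : Tendsto (fun k => δ n + δ k) atTop (𝓝 (δ n)) := by
      simpa using hδlim.const_add (δ n)
    exact le_of_tendsto_of_tendsto h1 h2 (Eventually.of_forall fun k => hdist n k t ht)
  have hlip : LipschitzOnWith γ.toNNReal Y (Ici t₀) := by
    refine lipschitzOnWith_Ici_of_sub_le fun s t hs hst => ?_
    refine le_of_tendsto (((hYlim t (hs.trans hst)).sub (hYlim s hs)).abs)
      (Eventually.of_forall fun n => ?_)
    simpa [abs_of_nonneg (sub_nonneg.2 hst)] using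
      abs_sub_le_of_eq_integral (hyr n).abs_le (hyr n).sub_eq s t
  have hYm : Measurable Y := by
    have h1 := hlip.continuousOn.measurable_piecewise (continuousOn_const (c := (0 : ℝ)))
      measurableSet_Ici
    convert h1 using 1
    funext t
    rcases lt_or_ge t t₀ with ht | ht
    · rw [piecewise_eq_of_notMem _ _ _ (by simpa using ht)]
      simp [hY, ht]
    · rw [piecewise_eq_of_mem _ _ _ (by simpa using ht)]
  refine ⟨Y, (isFilippovSolution_relay_iff hγ).2 ⟨?_, hlip, ?_⟩, fun t ht => by simp [hY, ht]⟩
  · refine tendsto_nhds_unique (hYlim t₀ le_rfl) ?_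
    simp only [fun n => (hyr n).init]
    exact tendsto_const_nhds
  · have hdown := deriv_le_of_tendsto_approx hγ hm hYm hδlim hyr herr
    -- The rate below m comes from the mirrored problem; the Lipschitz bound then turns both
    -- inequalities into equalities.
    have hup := deriv_le_of_tendsto_approx (Y := -Y) (y := fun n => -y n) hγ hm.neg hYm.neg hδlim
      (fun n => (hyr n).neg) (fun n t ht => by
        have := herr n t ht
        rwa [Pi.neg_apply, Pi.neg_apply, ← neg_sub', abs_neg])
    have hdiff := (ae_restrict_iff' measurableSet_Ici).1
      (hlip.ae_differentiableWithinAt (μ := volume) measurableSet_Ici)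
    filter_upwards [hdown, hup, hdiff] with t htd htu hdt htt
    have hn : Ici t₀ ∈ 𝓝 t := Ici_mem_nhds htt
    have hd := (hdt (mem_Ici.2 htt.le)).differentiableAt hn
    have hb := norm_deriv_le_of_lipschitzOn hn hlip
    rw [Real.norm_eq_abs, Real.coe_toNNReal _ hγ.le, abs_le] at hb
    refine ⟨fun h => ?_, fun h => ?_⟩
    · rw [← le_antisymm (htd htt h hd) hb.1]
      exact hd.hasDerivAt
    · have := htu htt (by simpa using h) hd.neg
      rw [deriv.neg] at this
      rw [← le_antisymm hb.2 (by linarith)]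
      exact hd.hasDerivAt

/-! ### The regularization -/

/-- The left intervals attached to non-interior points of S are pairwise disjoint: if two met, the
smaller point would be interior. Hence S is an open set plus a countable one. -/
lemma measurableSet_of_exists_Ioo_subset {S : Set ℝ} (h : ∀ t ∈ S, ∃ a < t, Ioo a t ⊆ S) :
    MeasurableSet S := by
  choose! a ha hS using h
  have hcount : (S \ interior S).Countable := by
    refine PairwiseDisjoint.countable_of_isOpen (s := fun t => Ioo (a t) t) ?_
      (fun t _ => isOpen_Ioo) (fun t ht => nonempty_Ioo.2 (ha t ht.1))
    have key : ∀ s ∈ S \ interior S, ∀ t ∈ S \ interior S, s < t →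
        Disjoint (Ioo (a s) s) (Ioo (a t) t) := by
      intro s hs t ht hst
      rw [Set.disjoint_left]
      intro x hx hx'
      exact hs.2 (interior_maximal (hS t ht.1) isOpen_Ioo ⟨hx'.1.trans hx.2, hst⟩)
    intro s hs t ht hne
    rcases lt_or_gt_of_ne hne with hlt | hlt
    · exact key s hs t ht hlt
    · exact (key t ht s hs hlt).symm
  rw [← union_sdiff_cancel (interior_subset (s := S))]
  exact isOpen_interior.measurableSet.union hcount.measurableSet

lemma eventually_left_of_eventually_left {p : ℝ → Prop} {t : ℝ}
    (h : ∀ᶠ ε in 𝓝[>] (0 : ℝ), p (t - ε)) :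
    ∃ a < t, ∀ s ∈ Ioo a t, ∀ᶠ ε in 𝓝[>] (0 : ℝ), p (s - ε) := by
  obtain ⟨u, hu, hsub⟩ := mem_nhdsGT_iff_exists_Ioo_subset.1 h
  have hu' : 0 < u := hu
  refine ⟨t - u, by linarith, fun s hs => ?_⟩
  filter_upwards [Ioo_mem_nhdsGT (show (0 : ℝ) < s - (t - u) by linarith [hs.1])] with ε hε
  have hmem : t - s + ε ∈ Ioo 0 u := ⟨by linarith [hs.2, hε.1], by linarith [hε.2]⟩
  have := hsub hmem
  simp only [mem_ofPred_eq] at this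
  convert this using 1
  ring

/-- A strict bound on the left limsup persists at all points of some interval to the left, so v
itself may be non-measurable, as the noise is. -/
lemma measurable_limsup_left (v : ℝ → EReal) :
    Measurable fun t : ℝ => limsup (fun ε : ℝ => v (t - ε)) (𝓝[>] 0) := by
  refine measurable_of_Iio fun c => measurableSet_of_exists_Ioo_subset fun t ht => ?_
  obtain ⟨c', hc, hc'⟩ := exists_between (show limsup (fun ε : ℝ => v (t - ε)) (𝓝[>] 0) < c from ht)
  obtain ⟨a, ha, h⟩ := eventually_left_of_eventually_left (p := fun x => v x < c')
    (eventually_lt_of_limsup_lt hc)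
  exact ⟨a, ha, fun s hs => lt_of_le_of_lt
    (limsup_le_of_le (h := (h s hs).mono fun _ h => h.le)) hc'⟩

lemma measurable_liminf_left (v : ℝ → EReal) :
    Measurable fun t : ℝ => liminf (fun ε : ℝ => v (t - ε)) (𝓝[>] 0) := by
  refine measurable_of_Ioi fun c => measurableSet_of_exists_Ioo_subset fun t ht => ?_
  obtain ⟨c', hc, hc'⟩ := exists_between (show c < liminf (fun ε : ℝ => v (t - ε)) (𝓝[>] 0) from ht)
  obtain ⟨a, ha, h⟩ := eventually_left_of_eventually_left (p := fun x => c' < v x)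
    (eventually_lt_of_lt_liminf hc')
  exact ⟨a, ha, fun s hs => lt_of_lt_of_le hc
    (le_liminf_of_le (h := (h s hs).mono fun _ h => h.le))⟩

lemma measurable_regularization (v : ℝ → ℝ) : Measurable (regularization v) := by
  classical
  have ha := measurable_limsup_left fun x => (v x : EReal)
  have hb := measurable_liminf_left fun x => (v x : EReal)
  unfold regularization
  refine Measurable.ite (measurableSet_singleton 0) measurable_const ?_
  refine Measurable.ite ((ha (measurableSet_singleton ⊤)).inter (hb (measurableSet_singleton ⊥)))
    measurable_const ?_
  simp only [div_eq_mul_inv]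
  exact (ha.add hb).mul_const _

lemma measurable_outM (L : ℝ) (Tbar : ℝ≥0∞) (u : ℝ → ℝ) : Measurable (outM L Tbar u) :=
  (measurable_regularization _).ereal_toReal

lemma abs_regularization_sub_le {v : ℝ → ℝ} {t x E : ℝ} (ht : 0 < t)
    (h : ∀ᶠ ε in 𝓝[>] (0 : ℝ), |v (t - ε) - x| ≤ E) :
    |(regularization v t).toReal - x| ≤ E := by
  have hsup : limsup (fun ε : ℝ => (v (t - ε) : EReal)) (𝓝[>] 0) ≤ ((x + E : ℝ) : EReal) :=
    limsup_le_of_le (h := h.mono fun ε hε => EReal.coe_le_coe_iff.2 (by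
      linarith [(abs_le.1 hε).2]))
  have hinf : ((x - E : ℝ) : EReal) ≤ liminf (fun ε : ℝ => (v (t - ε) : EReal)) (𝓝[>] 0) :=
    le_liminf_of_le (h := h.mono fun ε hε => EReal.coe_le_coe_iff.2 (by
      linarith [(abs_le.1 hε).1]))
  have hle : liminf (fun ε : ℝ => (v (t - ε) : EReal)) (𝓝[>] 0) ≤
      limsup (fun ε : ℝ => (v (t - ε) : EReal)) (𝓝[>] 0) := liminf_le_limsup
  unfold regularization
  rw [if_neg ht.ne']
  generalize limsup (fun ε : ℝ => (v (t - ε) : EReal)) (𝓝[>] 0) = a at *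
  generalize liminf (fun ε : ℝ => (v (t - ε) : EReal)) (𝓝[>] 0) = b at *
  induction a with
  | bot => exact absurd (hinf.trans hle) (not_le.2 (EReal.bot_lt_coe _))
  | top => exact absurd hsup (not_le.2 (EReal.coe_lt_top _))
  | coe a =>
    induction b with
    | bot => exact absurd hinf (not_le.2 (EReal.bot_lt_coe _))
    | top => exact absurd hle (by simp)
    | coe b =>
      rw [EReal.coe_le_coe_iff] at hsup hinf hle
      have h2 : ((a : EReal) + b) / 2 = (((a + b) / 2 : ℝ) : EReal) := by norm_cast
      simp only [EReal.coe_ne_top, false_and, if_false, h2, EReal.toReal_coe]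
      rw [abs_le]
      constructor <;> linarith

lemma regularization_congr {v w : ℝ → ℝ} {t : ℝ} (ht : 0 ≤ t) (h : ∀ s ∈ Icc 0 t, v s = w s) :
    regularization v t = regularization w t := by
  unfold regularization
  split_ifs with h0
  · rw [h 0 ⟨le_rfl, ht⟩]
  · have hev : (fun ε : ℝ => (v (t - ε) : EReal)) =ᶠ[𝓝[>] 0] fun ε => (w (t - ε) : EReal) := by
      filter_upwards [Ioo_mem_nhdsGT (lt_of_le_of_ne ht (Ne.symm h0))] with ε hε
      rw [h _ ⟨by linarith [hε.2], by linarith [hε.1]⟩]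
    simp only [limsup_congr hev, liminf_congr hev]

/-! ### Signals with bounded second derivative -/

lemma hasDerivAt_of_mem_signalClass {L : ℝ} {f : ℝ → ℝ} (hf : f ∈ signalClass L) {t : ℝ}
    (ht : 0 < t) : HasDerivAt f (sigDeriv f t) t := by
  have h := (hf.1.1 t ht.le).hasDerivWithinAt.hasDerivAt (Ici_mem_nhds ht)
  exact h

lemma abs_sigDeriv_sub_le {L : ℝ} {f : ℝ → ℝ} (hf : f ∈ signalClass L) {s t : ℝ} (hs : 0 ≤ s)
    (hst : s ≤ t) : |sigDeriv f t - sigDeriv f s| ≤ L * (t - s) := by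
  obtain ⟨⟨-, K, hK⟩, hae⟩ := hf
  refine abs_sub_le_of_ae_abs_deriv_le hst
    (hK.mono (uIcc_subset_Ici hs (hs.trans hst))).absolutelyContinuousOnInterval ?_
  filter_upwards [(ae_restrict_iff' measurableSet_Ici).1 hae] with r hr hrm
  have hr0 : 0 < r := lt_of_le_of_lt hs hrm.1
  have := hr (mem_Ici.2 hr0.le)
  rwa [sigDeriv, derivWithin_of_mem_nhds (Ici_mem_nhds hr0)] at this

/-- The backward difference quotient. -/
noncomputable def backSlope (u : ℝ → ℝ) (t T : ℝ) : ℝ := (u t - u (t - T)) / T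

/-- Converts bounds on Q into control of how the slope depends on the window length. -/
lemma devQ_eq (u : ℝ → ℝ) (t : ℝ) {T σ : ℝ} (hσ : σ ≠ 0) :
    devQ u t T σ = σ * (backSlope u t T - backSlope u t σ) := by
  unfold devQ backSlope
  field_simp
  ring

lemma convexOn_of_sigDeriv {f : ℝ → ℝ} {L : ℝ} (c : ℝ) (hc : c = 1 ∨ c = -1)
    (hf : f ∈ signalClass L) : ConvexOn ℝ (Ici 0) fun x => c * f x + L * x ^ 2 / 2 := by
  have hder : ∀ x ∈ Ioi (0 : ℝ),
      HasDerivAt (fun x => c * f x + L * x ^ 2 / 2) (c * sigDeriv f x + L * x) x := fun x hx => by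
    have h1 := (hasDerivAt_of_mem_signalClass hf (mem_Ioi.1 hx)).const_mul c
    have h2 := (((hasDerivAt_id x).pow 2).const_mul L).div_const 2
    refine (h1.add h2).congr_deriv ?_
    simp only [id_eq, Nat.cast_ofNat]
    ring
  refine MonotoneOn.convexOn_of_deriv (convex_Ici 0) ?_ ?_ ?_
  · exact (hf.1.1.continuousOn.const_smul c).add (by fun_prop)
  · rw [interior_Ici]
    exact fun x hx => (hder x hx).differentiableAt.differentiableWithinAt
  · rw [interior_Ici]
    intro x hx y hy hxy
    rw [(hder x hx).deriv, (hder y hy).deriv]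
    have := abs_le.1 (abs_sigDeriv_sub_le hf (le_of_lt (mem_Ioi.1 hx)) hxy)
    rcases hc with rfl | rfl <;> nlinarith

/-- Q is the deviation of f from its chord at t - σ. As ±f + Lx²/2 are convex, it is at most the
chord deviation of the parabola Lx²/2, which is the stated bound. -/
lemma abs_devQ_le {f : ℝ → ℝ} {L : ℝ} (hf : f ∈ signalClass L) {t T σ : ℝ} (hT : 0 < T)
    (hTt : T ≤ t) (hσ : σ ∈ Icc 0 T) : |devQ f t T σ| ≤ L * σ * (T - σ) / 2 := by
  have key : ∀ c : ℝ, (c = 1 ∨ c = -1) → c * devQ f t T σ ≤ L * σ * (T - σ) / 2 := by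
    intro c hc
    have h := (convexOn_of_sigDeriv c hc hf).2 (show t ∈ Ici 0 from hT.le.trans hTt)
      (show t - T ∈ Ici 0 from sub_nonneg.2 hTt)
      (show 0 ≤ 1 - σ / T by rw [sub_nonneg, div_le_one hT]; exact hσ.2)
      (show 0 ≤ σ / T from div_nonneg hσ.1 hT.le) (by ring)
    simp only [smul_eq_mul] at h
    have hx : (1 - σ / T) * t + σ / T * (t - T) = t - σ := by field_simp; ring
    rw [hx] at h
    have e1 : c * devQ f t T σ =
        c * f (t - σ) - ((1 - σ / T) * (c * f t) + σ / T * (c * f (t - T))) := by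
      unfold devQ; field_simp; ring
    have e2 : (1 - σ / T) * (L * t ^ 2 / 2) + σ / T * (L * (t - T) ^ 2 / 2) - L * (t - σ) ^ 2 / 2
        = L * σ * (T - σ) / 2 := by field_simp; ring
    rw [e1, ← e2]
    linarith
  rw [abs_le]
  constructor
  · linarith [key (-1) (Or.inr rfl)]
  · linarith [key 1 (Or.inl rfl)]

lemma devQ_add (f η : ℝ → ℝ) (t T σ : ℝ) :
    devQ (f + η) t T σ = devQ f t T σ + devQ η t T σ := by
  simp only [devQ, Pi.add_apply]
  ring

/-- Q is one noise value minus a convex combination of two others, hence 2N. -/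
lemma abs_devQ_noise_le {η : ℝ → ℝ} {N : ℝ} (hη : η ∈ noiseClass N) {t T σ : ℝ} (hT : 0 < T)
    (hTt : T ≤ t) (hσ : σ ∈ Icc 0 T) : |devQ η t T σ| ≤ 2 * N := by
  have h1 := abs_le.1 (hη t (hT.le.trans hTt))
  have h2 := abs_le.1 (hη (t - T) (sub_nonneg.2 hTt))
  have h3 := abs_le.1 (hη (t - σ) (by linarith [hσ.2]))
  have e : devQ η t T σ = η (t - σ) - ((1 - σ / T) * η t + σ / T * η (t - T)) := by
    unfold devQ; field_simp; ring
  have ha : 0 ≤ σ / T := div_nonneg hσ.1 hT.le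
  have hb : 0 ≤ 1 - σ / T := by rw [sub_nonneg, div_le_one hT]; exact hσ.2
  rw [e, abs_le]
  constructor <;> nlinarith

/-! ### The noise amplitude estimate and the time difference -/

section Estimate

variable {L N : ℝ} {Tbar : ℝ≥0∞} {f η : ℝ → ℝ}

lemma abs_devQ_add_sub_le (hf : f ∈ signalClass L) (hη : η ∈ noiseClass N) {t T σ : ℝ}
    (hT : 0 < T) (hTt : T ≤ t) (hσ : σ ∈ Icc 0 T) :
    |devQ (f + η) t T σ| - L * σ * (T - σ) / 2 ≤ 2 * N := by
  rw [devQ_add]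
  linarith [abs_add_le (devQ f t T σ) (devQ η t T σ), abs_devQ_le hf hT hTt hσ,
    abs_devQ_noise_le hη hT hTt hσ]

lemma noiseEst_le (hN : 0 ≤ N) (hf : f ∈ signalClass L) (hη : η ∈ noiseClass N) (t : ℝ) :
    noiseEst L Tbar (f + η) t ≤ N := by
  have : sSup {x : ℝ | ∃ T σ : ℝ, 0 < T ∧ ENNReal.ofReal T ≤ Tbar ∧ T ≤ t ∧ σ ∈ Icc 0 T ∧
      x = |devQ (f + η) t T σ| - L * σ * (T - σ) / 2} ≤ 2 * N := by
    -- For t ≤ 0 no window exists and `sSup` takes the value 0, which is covered by `0 ≤ N`.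
    refine Real.sSup_le ?_ (by linarith)
    rintro _ ⟨T, σ, hT, -, hTt, hσ, rfl⟩
    exact abs_devQ_add_sub_le hf hη hT hTt hσ
  unfold noiseEst
  linarith

lemma abs_devQ_le_noiseEst (hf : f ∈ signalClass L) (hη : η ∈ noiseClass N) {t T σ : ℝ}
    (hT : 0 < T) (hTb : ENNReal.ofReal T ≤ Tbar) (hTt : T ≤ t) (hσ : σ ∈ Icc 0 T) :
    |devQ (f + η) t T σ| ≤ 2 * noiseEst L Tbar (f + η) t + L * σ * (T - σ) / 2 := by
  have : |devQ (f + η) t T σ| - L * σ * (T - σ) / 2 ≤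
      sSup {x : ℝ | ∃ T σ : ℝ, 0 < T ∧ ENNReal.ofReal T ≤ Tbar ∧ T ≤ t ∧ σ ∈ Icc 0 T ∧
      x = |devQ (f + η) t T σ| - L * σ * (T - σ) / 2} := by
    refine le_csSup ⟨2 * N, ?_⟩ ⟨T, σ, hT, hTb, hTt, hσ, rfl⟩
    rintro _ ⟨T, σ, hT, -, hTt, hσ, rfl⟩
    exact abs_devQ_add_sub_le hf hη hT hTt hσ
  unfold noiseEst
  linarith

lemma noiseEst_nonneg (hf : f ∈ signalClass L) (hη : η ∈ noiseClass N) {t T : ℝ}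
    (hT : 0 < T) (hTb : ENNReal.ofReal T ≤ Tbar) (hTt : T ≤ t) :
    0 ≤ noiseEst L Tbar (f + η) t := by
  have := abs_devQ_le_noiseEst hf hη hT hTb hTt ⟨le_rfl, hT.le⟩
  simp only [devQ, sub_zero, sub_self, mul_zero, add_zero, abs_zero, zero_mul, zero_div] at this
  linarith

lemma ofReal_timeDiff (L : ℝ) (Tbar : ℝ≥0∞) (u : ℝ → ℝ) (t : ℝ) :
    ENNReal.ofReal (timeDiff L Tbar u t) = min (min (ENNReal.ofReal t) Tbar)
      (ENNReal.ofReal (2 * √(noiseEst L Tbar u t / L))) :=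
  ENNReal.ofReal_toReal (ne_top_of_le_ne_top ENNReal.ofReal_ne_top (min_le_right _ _))

lemma timeDiff_nonneg (L : ℝ) (Tbar : ℝ≥0∞) (u : ℝ → ℝ) (t : ℝ) : 0 ≤ timeDiff L Tbar u t :=
  ENNReal.toReal_nonneg

lemma timeDiff_le {u : ℝ → ℝ} {t : ℝ} (ht : 0 ≤ t) : timeDiff L Tbar u t ≤ t := by
  rw [← ENNReal.ofReal_le_ofReal_iff ht, ofReal_timeDiff]
  exact (min_le_left _ _).trans (min_le_left _ _)

lemma timeDiff_le_sqrt (L : ℝ) (Tbar : ℝ≥0∞) (u : ℝ → ℝ) (t : ℝ) :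
    timeDiff L Tbar u t ≤ 2 * √(noiseEst L Tbar u t / L) := by
  rw [← ENNReal.ofReal_le_ofReal_iff (by positivity), ofReal_timeDiff]
  exact min_le_right _ _

/-- Below an admissible window neither t nor `Tbar` attains the minimum. This allows N̂ = L T̂²/4 to
be recovered from T̂. -/
lemma timeDiff_eq_of_lt {u : ℝ → ℝ} {t S : ℝ} (h : timeDiff L Tbar u t < S) (hSt : S ≤ t)
    (hSb : ENNReal.ofReal S ≤ Tbar) :
    timeDiff L Tbar u t = 2 * √(noiseEst L Tbar u t / L) := by
  have h0 := timeDiff_nonneg L Tbar u t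
  refine le_antisymm (timeDiff_le_sqrt L Tbar u t) ?_
  have h1 : min (min (ENNReal.ofReal t) Tbar)
      (ENNReal.ofReal (2 * √(noiseEst L Tbar u t / L))) < ENNReal.ofReal S := by
    rw [← ofReal_timeDiff]
    exact (ENNReal.ofReal_lt_ofReal_iff (lt_of_le_of_lt h0 h)).2 h
  rw [← ENNReal.ofReal_le_ofReal_iff h0, ofReal_timeDiff]
  rcases min_lt_iff.1 h1 with h2 | h2
  · exact absurd h2 (not_lt.2 (le_min (ENNReal.ofReal_le_ofReal hSt) hSb))
  · exact le_min (h2.le.trans (le_min (ENNReal.ofReal_le_ofReal hSt) hSb)) le_rfl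

/-! ### Accuracy of the difference quotients -/

lemma backSlope_tendsto (hf : f ∈ signalClass L) {t : ℝ} (ht : 0 < t) :
    Tendsto (backSlope f t) (𝓝[>] 0) (𝓝 (sigDeriv f t)) := by
  have h1 : HasDerivAt (fun T => f (t - T)) (-sigDeriv f t) 0 := by
    have := (hasDerivAt_of_mem_signalClass hf ht)
    have h2 : HasDerivAt f (sigDeriv f t) (t - 0) := by simpa using this
    simpa using h2.comp_const_sub t 0
  have h2 := (hasDerivAt_iff_tendsto_slope.1 h1).mono_left
    (nhdsWithin_mono 0 (fun x (hx : x ∈ Ioi (0 : ℝ)) => ne_of_gt hx))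
  have h3 := h2.neg
  rw [neg_neg] at h3
  refine h3.congr' (Eventually.of_forall fun T => ?_)
  simp only [slope_def_field, backSlope, sub_zero]
  rw [← neg_div]
  ring

lemma abs_backSlope_sub_le_of_tendsto {u : ℝ → ℝ} {t S d C : ℝ} (hS : 0 < S)
    (hd : Tendsto (backSlope u t) (𝓝[>] 0) (𝓝 d))
    (h : ∀ σ ∈ Ioo 0 S, |devQ u t S σ| ≤ C * σ * (S - σ) / 2) :
    |backSlope u t S - d| ≤ C * S / 2 := by
  have hlim : Tendsto (fun σ : ℝ => C * (S - σ) / 2) (𝓝[>] 0) (𝓝 (C * S / 2)) := by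
    have : Continuous fun σ : ℝ => C * (S - σ) / 2 := by fun_prop
    simpa using (this.tendsto 0).mono_left nhdsWithin_le_nhds
  refine le_of_tendsto_of_tendsto (tendsto_const_nhds.sub hd).abs hlim ?_
  filter_upwards [Ioo_mem_nhdsGT hS] with σ hσ
  have h1 := h σ hσ
  rw [devQ_eq u t hσ.1.ne', abs_mul, abs_of_pos hσ.1] at h1
  have h2 : σ * |backSlope u t S - backSlope u t σ| ≤ σ * (C * (S - σ) / 2) := by linarith
  exact le_of_mul_le_mul_left h2 hσ.1

lemma abs_backSlope_add_sub_le (hf : f ∈ signalClass L) (hη : η ∈ noiseClass N) {t S : ℝ}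
    (hS : 0 < S) (hSt : S ≤ t) :
    |backSlope (f + η) t S - sigDeriv f t| ≤ L * S / 2 + 2 * N / S := by
  have h1 := abs_backSlope_sub_le_of_tendsto hS (backSlope_tendsto hf (hS.trans_le hSt))
    fun σ hσ => abs_devQ_le hf hS hSt ⟨hσ.1.le, hσ.2.le⟩
  have h2 : backSlope (f + η) t S = backSlope f t S + (η t - η (t - S)) / S := by
    simp only [backSlope, Pi.add_apply]
    ring
  have h3 : |(η t - η (t - S)) / S| ≤ 2 * N / S := by
    rw [abs_div, abs_of_pos hS]
    gcongr
    linarith [abs_sub (η t) (η (t - S)), hη t (hS.le.trans hSt), hη (t - S) (sub_nonneg.2 hSt)]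
  have h4 := abs_add_le (backSlope f t S - sigDeriv f t) ((η t - η (t - S)) / S)
  have e : backSlope (f + η) t S - sigDeriv f t =
      (backSlope f t S - sigDeriv f t) + (η t - η (t - S)) / S := by rw [h2]; ring
  rw [e]
  linarith

/-- Needed when N̂(t) = 0 although noise may be present: the slope is then Lipschitz in the window
length and extends continuously to 0, so the `limUnder` in `outW` is a genuine limit. -/
lemma exists_tendsto_backSlope {u : ℝ → ℝ} {t S : ℝ} (hS : 0 < S)
    (h : ∀ T ∈ Ioc 0 S, ∀ σ ∈ Icc 0 T, |devQ u t T σ| ≤ L * σ * (T - σ) / 2) :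
    ∃ d, Tendsto (backSlope u t) (𝓝[>] 0) (𝓝 d) := by
  have key : ∀ σ ∈ Ioc 0 S, ∀ T ∈ Ioc 0 S, σ ≤ T →
      |backSlope u t T - backSlope u t σ| ≤ L / 2 * (T - σ) := by
    intro σ hσ T hT hle
    have h1 := h T hT σ ⟨hσ.1.le, hle⟩
    rw [devQ_eq u t hσ.1.ne', abs_mul, abs_of_pos hσ.1] at h1
    have h2 : σ * |backSlope u t T - backSlope u t σ| ≤ σ * (L / 2 * (T - σ)) := by linarith
    exact le_of_mul_le_mul_left h2 hσ.1
  have hlip : LipschitzOnWith (L / 2).toNNReal (backSlope u t) (Ioc 0 S) := by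
    refine LipschitzOnWith.of_dist_le' fun σ hσ T hT => ?_
    rw [Real.dist_eq, Real.dist_eq]
    rcases le_total σ T with hle | hle
    · rw [abs_sub_comm, abs_sub_comm σ, abs_of_nonneg (sub_nonneg.2 hle)]
      exact key σ hσ T hT hle
    · rw [abs_of_nonneg (sub_nonneg.2 hle)]
      exact key T hT σ hσ hle
  obtain ⟨g, hg, hgeq⟩ := hlip.extend_real
  refine ⟨g 0, ((hg.continuous.tendsto 0).mono_left nhdsWithin_le_nhds).congr' ?_⟩
  filter_upwards [Ioc_mem_nhdsGT hS] with T hT using (hgeq hT).symm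

lemma outW_of_timeDiff_ne_zero {u : ℝ → ℝ} {t : ℝ} (ht : t ≠ 0) (h : timeDiff L Tbar u t ≠ 0) :
    outW L Tbar u t = backSlope u t (timeDiff L Tbar u t) := by
  rw [outW, if_neg ht, if_neg h, backSlope]

/-- The choice of T̂ pays off here: with 2N̂ = L T̂²/2, the bound 2N̂ + L T̂(S - T̂)/2 on |Q(t, S,
T̂)| collapses to L T̂ S/2, and T̂ cancels. -/
lemma abs_outW_sub_backSlope_le (hL : 0 < L) (hf : f ∈ signalClass L) (hη : η ∈ noiseClass N)
    {t S : ℝ} (hS : 0 < S) (hSt : S ≤ t) (hSb : ENNReal.ofReal S ≤ Tbar)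
    (hle : timeDiff L Tbar (f + η) t ≤ S) :
    |outW L Tbar (f + η) t - backSlope (f + η) t S| ≤ L * S / 2 := by
  have ht : 0 < t := hS.trans_le hSt
  have hpos : 0 ≤ L * S / 2 := by positivity
  rcases hle.eq_or_lt with heq | hlt
  · rw [outW_of_timeDiff_ne_zero ht.ne' (by rw [heq]; exact hS.ne'), heq, sub_self, abs_zero]
    exact hpos
  have hsqrt := timeDiff_eq_of_lt hlt hSt hSb
  have hnn := noiseEst_nonneg hf hη hS hSb hSt
  have hest : noiseEst L Tbar (f + η) t = L * timeDiff L Tbar (f + η) t ^ 2 / 4 := by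
    rw [hsqrt, mul_pow, Real.sq_sqrt (by positivity)]
    field_simp
    ring
  have hdev := fun σ (hσ : σ ∈ Icc 0 S) => abs_devQ_le_noiseEst hf hη hS hSb hSt hσ
  rw [abs_sub_comm]
  rcases (timeDiff_nonneg L Tbar (f + η) t).eq_or_lt with h0 | h0
  · have hz : noiseEst L Tbar (f + η) t = 0 := by rw [hest, ← h0]; ring
    obtain ⟨d, hd⟩ := exists_tendsto_backSlope (L := L) (u := f + η) (t := t) hS
      fun T hT σ hσ => by
        have := abs_devQ_le_noiseEst (Tbar := Tbar) hf hη hT.1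
          ((ENNReal.ofReal_le_ofReal hT.2).trans hSb) (hT.2.trans hSt) hσ
        rw [hz] at this
        linarith
    have hout : outW L Tbar (f + η) t = d := by
      rw [outW, if_neg ht.ne', if_pos h0.symm]
      exact hd.limUnder_eq
    rw [hout]
    refine abs_backSlope_sub_le_of_tendsto hS hd fun σ hσ => ?_
    have := hdev σ ⟨hσ.1.le, hσ.2.le⟩
    rw [hz] at this
    linarith
  · rw [outW_of_timeDiff_ne_zero ht.ne' h0.ne']
    have h1 := hdev _ ⟨h0.le, hlt.le⟩
    rw [devQ_eq _ _ h0.ne', abs_mul, abs_of_pos h0, hest] at h1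
    refine le_of_mul_le_mul_left (h1.trans (le_of_eq ?_)) h0
    ring

/-- The time after which the worst-case accuracy is reached. -/
noncomputable def settlingTime (L N : ℝ) : ℝ := √(2 * N / L)

/-- The error bound of the optimal exact differentiator at time `t`. -/
noncomputable def errorBound (L N t : ℝ) : ℝ :=
  L * min t (settlingTime L N) + 2 * N / min t (settlingTime L N)

lemma settlingTime_nonneg (L N : ℝ) : 0 ≤ settlingTime L N := Real.sqrt_nonneg _

lemma settlingTime_pos (hL : 0 < L) (hN : 0 < N) : 0 < settlingTime L N :=
  Real.sqrt_pos.2 (by positivity)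

lemma settlingTime_sq (hL : 0 < L) (hN : 0 ≤ N) : L * settlingTime L N ^ 2 = 2 * N := by
  rw [settlingTime, Real.sq_sqrt (by positivity)]
  field_simp

/-- Here the minimum is 0, and the quotient is 0/0 = 0 by convention. -/
lemma errorBound_zero {t : ℝ} (ht : 0 ≤ t) : errorBound L 0 t = 0 := by
  simp [errorBound, settlingTime, ht]

lemma errorBound_of_le (hL : 0 < L) (hN : 0 ≤ N) {t : ℝ} (ht : settlingTime L N ≤ t) :
    errorBound L N t = 2 * L * settlingTime L N := by
  rw [errorBound, min_eq_right ht, ← settlingTime_sq hL hN]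
  rcases (settlingTime_nonneg L N).eq_or_lt with h | h
  · simp [← h]
  · field_simp
    ring

lemma abs_outW_sub_le (hL : 0 < L) (hN : 0 ≤ N) (hTbar : 0 < Tbar) (hf : f ∈ signalClass L)
    (hη : η ∈ noiseClass N) (hTb : ENNReal.ofReal (settlingTime L N) ≤ Tbar) {t : ℝ}
    (ht : 0 < t) : |outW L Tbar (f + η) t - sigDeriv f t| ≤ errorBound L N t := by
  have main : ∀ S, 0 < S → S ≤ t → ENNReal.ofReal S ≤ Tbar → timeDiff L Tbar (f + η) t ≤ S →
      |outW L Tbar (f + η) t - sigDeriv f t| ≤ L * S + 2 * N / S := by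
    intro S hS hSt hSb hle
    have h1 := abs_outW_sub_backSlope_le hL hf hη hS hSt hSb hle
    have h2 := abs_backSlope_add_sub_le hf hη hS hSt
    have h3 := abs_sub_le (outW L Tbar (f + η) t) (backSlope (f + η) t S) (sigDeriv f t)
    linarith
  have hsq : timeDiff L Tbar (f + η) t ≤ 2 * √(N / L) := by
    refine (timeDiff_le_sqrt L Tbar (f + η) t).trans ?_
    gcongr
    exact noiseEst_le hN hf hη t
  rcases hN.eq_or_lt with rfl | hN0
  · rw [errorBound_zero ht.le]
    have h0 : timeDiff L Tbar (f + η) t ≤ 0 := by simpa using hsq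
    -- Without noise every small window is admissible, and the bound follows by shrinking it to 0.
    have hlim : Tendsto (fun S : ℝ => L * S + 2 * 0 / S) (𝓝[>] 0) (𝓝 0) := by
      have : Continuous fun S : ℝ => L * S := by fun_prop
      simpa using (this.tendsto 0).mono_left nhdsWithin_le_nhds
    have hsmall : ∀ᶠ S : ℝ in 𝓝[>] 0, ENNReal.ofReal S < Tbar := by
      have : Tendsto ENNReal.ofReal (𝓝[>] 0) (𝓝 (ENNReal.ofReal 0)) :=
        (ENNReal.continuous_ofReal.tendsto 0).mono_left nhdsWithin_le_nhds
      exact this.eventually_lt_const (by simpa using hTbar)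
    refine ge_of_tendsto hlim ?_
    filter_upwards [hsmall, Ioc_mem_nhdsGT ht] with S hS hSt
    exact main S hSt.1 hSt.2 hS.le (h0.trans hSt.1.le)
  have hT := settlingTime_pos hL hN0
  set S := min t (settlingTime L N) with hSdef
  have hS : 0 < S := lt_min ht hT
  have hSb : ENNReal.ofReal S ≤ Tbar := (ENNReal.ofReal_le_ofReal (min_le_right _ _)).trans hTb
  rcases le_or_gt (timeDiff L Tbar (f + η) t) S with hle | hgt
  · exact main S hS (min_le_left _ _) hSb hle
  -- Since T̂ ≤ t, the case T̂ > S rules out S = t. Then h < T̂ ≤ 2h, and the direct estimate over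
  -- T̂ is already good enough.
  have hSeq : S = settlingTime L N := by
    rcases min_choice t (settlingTime L N) with h | h
    · rw [← hSdef] at h
      exact absurd (timeDiff_le (L := L) (Tbar := Tbar) (u := f + η) ht.le) (by linarith)
    · exact h
  have h0 : 0 < timeDiff L Tbar (f + η) t := hS.trans hgt
  rw [outW_of_timeDiff_ne_zero ht.ne' h0.ne']
  refine (abs_backSlope_add_sub_le hf hη h0 (timeDiff_le ht.le)).trans ?_
  have h2 : √(N / L) ≤ settlingTime L N := by
    refine Real.sqrt_le_sqrt ?_
    gcongr
    linarith
  have h3 : L * timeDiff L Tbar (f + η) t / 2 ≤ L * S := by rw [hSeq]; nlinarith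
  have h4 : 2 * N / timeDiff L Tbar (f + η) t ≤ 2 * N / S := by gcongr
  exact add_le_add h3 h4

lemma continuousOn_errorBound (hL : 0 < L) (hN : 0 ≤ N) :
    ContinuousOn (errorBound L N) (Ioi 0) := by
  rcases hN.eq_or_lt with rfl | hN0
  · exact continuousOn_const.congr fun t ht => errorBound_zero (le_of_lt (mem_Ioi.1 ht))
  · have hT := settlingTime_pos hL hN0
    unfold errorBound
    refine ContinuousOn.add (by fun_prop) (ContinuousOn.div (by fun_prop) (by fun_prop) ?_)
    exact fun t ht => (lt_min (mem_Ioi.1 ht) hT).ne'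

/-- Comparing `y_w` at t - ε with f'(t) costs an extra Lε. This vanishes in the left limit, and the
error bound is continuous at t > 0. -/
lemma abs_outM_sub_le (hL : 0 < L) (hN : 0 ≤ N) (hTbar : 0 < Tbar) (hf : f ∈ signalClass L)
    (hη : η ∈ noiseClass N) (hTb : ENNReal.ofReal (settlingTime L N) ≤ Tbar) {t : ℝ}
    (ht : 0 < t) : |outM L Tbar (f + η) t - sigDeriv f t| ≤ errorBound L N t := by
  refine le_of_forall_gt_imp_ge_of_dense fun E hE => abs_regularization_sub_le ht ?_
  have hcont : ContinuousAt (fun ε => errorBound L N (t - ε) + L * ε) 0 := by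
    refine ContinuousAt.add ?_ (by fun_prop)
    refine ContinuousAt.comp (g := errorBound L N) (f := fun ε : ℝ => t - ε) ?_ (by fun_prop)
    simpa using (continuousOn_errorBound hL hN).continuousAt (Ioi_mem_nhds ht)
  have hev : ∀ᶠ ε in 𝓝[>] (0 : ℝ), errorBound L N (t - ε) + L * ε < E :=
    (hcont.tendsto.mono_left nhdsWithin_le_nhds).eventually_lt_const (by simpa using hE)
  filter_upwards [hev, Ioo_mem_nhdsGT ht] with ε hε hεt
  have h1 := abs_outW_sub_le hL hN hTbar hf hη hTb (show 0 < t - ε by linarith [hεt.2])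
  have h2 := abs_sigDeriv_sub_le hf (show 0 ≤ t - ε by linarith [hεt.2])
    (show t - ε ≤ t by linarith [hεt.1])
  rw [abs_le] at h1 h2 ⊢
  constructor <;> linarith

end Estimate

/-! ### The filtered differentiator -/

lemma exists_isFilterOutput (L : ℝ) (Tbar : ℝ≥0∞) {γ : ℝ} (hγ : 0 < γ) (t₀ : ℝ) (u : ℝ → ℝ) :
    ∃ y, IsFilterOutput L Tbar γ t₀ u y :=
  exists_isFilippovSolution_relay hγ (measurable_outM L Tbar u) t₀ _

lemma filteredDiff_spec (L : ℝ) (Tbar : ℝ≥0∞) {γ : ℝ} (hγ : 0 < γ) (t₀ : ℝ) (u : ℝ → ℝ) :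
    IsFilterOutput L Tbar γ t₀ u (filteredDiff L Tbar γ t₀ u) :=
  Classical.epsilon_spec (exists_isFilterOutput L Tbar hγ t₀ u)

lemma filteredDiff_isFilippovSolution (L : ℝ) (Tbar : ℝ≥0∞) {γ : ℝ} (hγ : 0 < γ) (t₀ : ℝ)
    (u : ℝ → ℝ) : IsFilippovSolution (relay γ (outM L Tbar u)) t₀ (outM L Tbar u t₀)
      (filteredDiff L Tbar γ t₀ u) :=
  (filteredDiff_spec L Tbar hγ t₀ u).1

lemma filteredDiff_of_lt (L : ℝ) (Tbar : ℝ≥0∞) {γ : ℝ} (hγ : 0 < γ) {t₀ t : ℝ} (ht : t < t₀)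
    (u : ℝ → ℝ) : filteredDiff L Tbar γ t₀ u t = 0 :=
  (filteredDiff_spec L Tbar hγ t₀ u).2 t ht

lemma IsFilterOutput.unique {L γ t₀ : ℝ} {Tbar : ℝ≥0∞} (hγ : 0 < γ) {u y z : ℝ → ℝ}
    (hy : IsFilterOutput L Tbar γ t₀ u y) (hz : IsFilterOutput L Tbar γ t₀ u z) : y = z := by
  funext t
  rcases lt_or_ge t t₀ with ht | ht
  · rw [hy.2 t ht, hz.2 t ht]
  · exact IsFilippovSolution.relay_eq (m := outM L Tbar u) (n := outM L Tbar u) hγ hy.1 hz.1 ht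
      fun _ _ => rfl

lemma filteredDiff_lipschitzOnWith (L : ℝ) (Tbar : ℝ≥0∞) {γ : ℝ} (hγ : 0 < γ) (t₀ : ℝ)
    (u : ℝ → ℝ) : LipschitzOnWith γ.toNNReal (filteredDiff L Tbar γ t₀ u) (Ici t₀) :=
  ((isFilippovSolution_relay_iff hγ).1 (filteredDiff_isFilippovSolution L Tbar hγ t₀ u)).2.1

/-! ### Causality -/

section Causality

variable {u v : ℝ → ℝ} {s t : ℝ}

lemma devQ_congr (h : ∀ r ∈ Icc 0 s, u r = v r) {T σ : ℝ} (hT : 0 < T) (hTs : T ≤ s)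
    (hσ : σ ∈ Icc 0 T) : devQ u s T σ = devQ v s T σ := by
  unfold devQ
  rw [h s ⟨hT.le.trans hTs, le_rfl⟩, h (s - σ) ⟨by linarith [hσ.2], by linarith [hσ.1]⟩,
    h (s - T) ⟨by linarith, by linarith⟩]

lemma noiseEst_congr (L : ℝ) (Tbar : ℝ≥0∞) (h : ∀ r ∈ Icc 0 s, u r = v r) :
    noiseEst L Tbar u s = noiseEst L Tbar v s := by
  unfold noiseEst
  congr 2
  ext x
  constructor
  · rintro ⟨T, σ, hT, hTb, hTs, hσ, rfl⟩
    exact ⟨T, σ, hT, hTb, hTs, hσ, by rw [devQ_congr h hT hTs hσ]⟩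
  · rintro ⟨T, σ, hT, hTb, hTs, hσ, rfl⟩
    exact ⟨T, σ, hT, hTb, hTs, hσ, by rw [devQ_congr h hT hTs hσ]⟩

lemma outW_congr (L : ℝ) (Tbar : ℝ≥0∞) (hs : 0 ≤ s) (h : ∀ r ∈ Icc 0 s, u r = v r) :
    outW L Tbar u s = outW L Tbar v s := by
  have hT : timeDiff L Tbar u s = timeDiff L Tbar v s := by
    rw [timeDiff, timeDiff, noiseEst_congr L Tbar h]
  have hq : ∀ T, 0 ≤ T → T ≤ s → (u s - u (s - T)) / T = (v s - v (s - T)) / T := by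
    intro T hT0 hTs
    rw [h s ⟨hs, le_rfl⟩, h (s - T) ⟨by linarith, by linarith⟩]
  unfold outW
  rw [hT]
  split_ifs with h0 h1
  · rfl
  · unfold limUnder
    congr 1
    refine Filter.map_congr ?_
    filter_upwards [Ioc_mem_nhdsGT (lt_of_le_of_ne hs (Ne.symm h0))] with T hT
      using hq T hT.1.le hT.2
  · exact hq _ (timeDiff_nonneg L Tbar v s) (timeDiff_le hs)

lemma outM_congr (L : ℝ) (Tbar : ℝ≥0∞) (ht : 0 ≤ t) (h : ∀ r ∈ Icc 0 t, u r = v r) :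
    outM L Tbar u t = outM L Tbar v t := by
  unfold outM
  rw [regularization_congr ht fun s hs =>
    outW_congr L Tbar hs.1 fun r hr => h r ⟨hr.1, hr.2.trans hs.2⟩]

lemma isCausal_filteredDiff (L : ℝ) (Tbar : ℝ≥0∞) {γ t₀ : ℝ} (hγ : 0 < γ) (ht₀ : 0 ≤ t₀) :
    IsCausal (filteredDiff L Tbar γ t₀) := by
  intro u _ v _ t ht h
  rcases lt_or_ge t t₀ with htt | htt
  · rw [filteredDiff_of_lt L Tbar hγ htt, filteredDiff_of_lt L Tbar hγ htt]
  · have hm : ∀ s ∈ Icc t₀ t, outM L Tbar u s = outM L Tbar v s := fun s hs =>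
      outM_congr L Tbar (ht₀.trans hs.1) fun r hr => h r ⟨hr.1, hr.2.trans hs.2⟩
    have hu := filteredDiff_isFilippovSolution L Tbar hγ t₀ u
    rw [hm t₀ ⟨le_rfl, htt⟩] at hu
    exact hu.relay_eq hγ (filteredDiff_isFilippovSolution L Tbar hγ t₀ v) htt
      fun s hs => hm s ⟨hs.1.le, hs.2.le⟩

end Causality

/-! ### Tracking of a slowly varying function -/

/-- Above g + B the solution is above m and falls at rate γ, while g falls at rate at most L. So y -
g drops at rate at least γ - L until it reaches B, and it cannot cross B upwards afterwards. -/
lemma IsFilippovSolution.relay_tracking_le {L γ t₀ y₀ : ℝ} (hγ : 0 < γ) (hL : L < γ)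
    {m y g : ℝ → ℝ} (hy : IsFilippovSolution (relay γ m) t₀ y₀ y) {a b B : ℝ} (ha : t₀ ≤ a)
    (hab : a ≤ b) (hg : ∀ s ∈ Icc a b, ∀ t ∈ Icc a b, s ≤ t → |g t - g s| ≤ L * (t - s))
    (hm : ∀ t ∈ Ioo a b, m t ≤ g t + B) :
    y b - g b ≤ max B (y a - g a - (γ - L) * (b - a)) := by
  have hdec : ∀ s ∈ Icc a b, (∀ r ∈ Ioo s b, B < y r - g r) →
      y b - g b ≤ y s - g s - (γ - L) * (b - s) := by
    intro s hs hr
    have h1 := hy.relay_sub_le hγ (ha.trans hs.1) hs.2 fun r hrm => by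
      linarith [hr r hrm, hm r ⟨lt_of_le_of_lt hs.1 hrm.1, hrm.2⟩]
    have h2 := abs_le.1 (hg s hs b ⟨hab, le_rfl⟩ hs.2)
    linarith
  by_cases h : ∃ r ∈ Icc a b, y r - g r ≤ B
  · obtain ⟨r, hr, hrB⟩ := h
    refine le_max_of_le_left ?_
    by_contra! hb
    have hyc : ContinuousOn y (Icc r b) :=
      ((isFilippovSolution_relay_iff hγ).1 hy).2.1.continuousOn.mono
        fun x hx => ha.trans (hr.1.trans hx.1)
    have hgc : ContinuousOn g (Icc r b) := by
      refine (LipschitzOnWith.of_dist_le' (K := L) fun s hs t ht => ?_).continuousOn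
      have hs' : s ∈ Icc a b := ⟨hr.1.trans hs.1, hs.2⟩
      have ht' : t ∈ Icc a b := ⟨hr.1.trans ht.1, ht.2⟩
      rw [Real.dist_eq, Real.dist_eq]
      rcases le_total s t with hst | hst
      · rw [abs_sub_comm, abs_sub_comm s, abs_of_nonneg (sub_nonneg.2 hst)]
        exact hg s hs' t ht' hst
      · rw [abs_of_nonneg (sub_nonneg.2 hst)]
        exact hg t ht' s hs' hst
    obtain ⟨s, hs, hsB, hsr⟩ := exists_last_le (z := fun t => y t - g t) hr.2 (hyc.sub hgc) hrB hb
    have h1 := hdec s ⟨hr.1.trans hs.1, hs.2.le⟩ fun x hx => hsr x ⟨hx.1, hx.2.le⟩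
    nlinarith [mul_nonneg (sub_nonneg.2 hL.le) (sub_nonneg.2 hs.2.le)]
  · push Not at h
    exact le_max_of_le_right (hdec a ⟨le_rfl, hab⟩ fun r hr => h r ⟨hr.1.le, hr.2.le⟩)

lemma IsFilippovSolution.abs_relay_tracking_le {L γ t₀ y₀ : ℝ} (hγ : 0 < γ) (hL : L < γ)
    {m y g : ℝ → ℝ} (hy : IsFilippovSolution (relay γ m) t₀ y₀ y) {a b B : ℝ} (ha : t₀ ≤ a)
    (hab : a ≤ b) (hg : ∀ s ∈ Icc a b, ∀ t ∈ Icc a b, s ≤ t → |g t - g s| ≤ L * (t - s))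
    (hm : ∀ t ∈ Ioo a b, |m t - g t| ≤ B) :
    |y b - g b| ≤ max B (|y a - g a| - (γ - L) * (b - a)) := by
  have h1 := hy.relay_tracking_le (B := B) hγ hL ha hab hg fun t ht => by
    linarith [(abs_le.1 (hm t ht)).2]
  have h2 := (hy.relay_neg hγ).relay_tracking_le (g := -g) (B := B) hγ hL ha hab
    (fun s hs t ht hst => by
      have := hg s hs t ht hst
      rwa [Pi.neg_apply, Pi.neg_apply, ← neg_sub', abs_neg])
    (fun t ht => by
      simp only [Pi.neg_apply]
      linarith [(abs_le.1 (hm t ht)).1])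
  simp only [Pi.neg_apply] at h2
  have h3 : y a - g a - (γ - L) * (b - a) ≤ |y a - g a| - (γ - L) * (b - a) := by
    linarith [le_abs_self (y a - g a)]
  have h4 : -y a - -g a - (γ - L) * (b - a) ≤ |y a - g a| - (γ - L) * (b - a) := by
    linarith [neg_abs_le (y a - g a)]
  have h5 := h1.trans (max_le_max le_rfl h3)
  have h6 := h2.trans (max_le_max le_rfl h4)
  rw [abs_le]
  constructor <;> linarith

/-! ### Convergence of the filtered differentiator -/

section Convergence

variable {L γ t₀ N : ℝ} {Tbar : ℝ≥0∞} {f η : ℝ → ℝ}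

lemma filteredDiff_tracking (hL : 0 < L) (hγ : L < γ) (ht₀ : 0 ≤ t₀)
    (hf : f ∈ signalClass L) {a b B : ℝ} (ha : t₀ ≤ a) (hab : a ≤ b) {u : ℝ → ℝ}
    (hB : ∀ t ∈ Ioo a b, |outM L Tbar u t - sigDeriv f t| ≤ B) :
    |filteredDiff L Tbar γ t₀ u b - sigDeriv f b| ≤
      max B (|filteredDiff L Tbar γ t₀ u a - sigDeriv f a| - (γ - L) * (b - a)) :=
  (filteredDiff_isFilippovSolution L Tbar (hL.trans hγ) t₀ u).abs_relay_tracking_le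
    (hL.trans hγ) hγ ha hab
    (fun _ hs _ _ hst => abs_sigDeriv_sub_le hf (ht₀.trans (ha.trans hs.1)) hst) hB

lemma filteredDiff_tracking_of_settlingTime_le (hL : 0 < L) (hγ : L < γ) (hTbar : 0 < Tbar)
    (ht₀ : 0 ≤ t₀) (hN : 0 ≤ N) (hTb : ENNReal.ofReal (settlingTime L N) ≤ Tbar)
    (hf : f ∈ signalClass L) (hη : η ∈ noiseClass N) {a b : ℝ} (ha : t₀ ≤ a)
    (haT : settlingTime L N ≤ a) (hab : a ≤ b) :
    |filteredDiff L Tbar γ t₀ (f + η) b - sigDeriv f b| ≤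
      max (2 * L * settlingTime L N)
        (|filteredDiff L Tbar γ t₀ (f + η) a - sigDeriv f a| - (γ - L) * (b - a)) := by
  refine filteredDiff_tracking hL hγ ht₀ hf ha hab fun t ht => ?_
  rw [← errorBound_of_le hL hN (haT.trans ht.1.le)]
  exact abs_outM_sub_le hL hN hTbar hf hη hTb (lt_of_le_of_lt (ht₀.trans ha) ht.1)

lemma abs_filteredDiff_sub_le_of_init_zero (hL : 0 < L) (hγ : L < γ) (hTbar : 0 < Tbar)
    (hN : 0 ≤ N) (hTb : ENNReal.ofReal (settlingTime L N) ≤ Tbar) (hf : f ∈ signalClass L)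
    (hη : η ∈ noiseClass N) {R₁ : ℝ} (hR : |sigDeriv f 0| ≤ R₁) {τ : ℝ}
    (hτ : 2 * settlingTime L N + R₁ / (γ - L) ≤ τ) :
    |filteredDiff L Tbar γ 0 (f + η) τ - sigDeriv f τ| ≤ 2 * L * settlingTime L N := by
  have hγ0 := hL.trans hγ
  have hd : 0 < γ - L := sub_pos.2 hγ
  set T := settlingTime L N with hT
  have hT0 : 0 ≤ T := settlingTime_nonneg L N
  have hR0 : 0 ≤ R₁ / (γ - L) := div_nonneg ((abs_nonneg _).trans hR) hd.le
  have h1 := filteredDiff_tracking_of_settlingTime_le hL hγ hTbar le_rfl hN hTb hf hη hT0 le_rfl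
    (show T ≤ τ by linarith)
  refine h1.trans (max_le le_rfl ?_)
  have h0 : filteredDiff L Tbar γ 0 (f + η) 0 = 0 := by
    rw [(filteredDiff_isFilippovSolution L Tbar hγ0 0 (f + η)).1]
    simp [outM, regularization, outW]
  have hl := abs_sub_le_of_lipschitzOnWith hγ0.le
    (filteredDiff_lipschitzOnWith L Tbar hγ0 0 (f + η)) (mem_Ici.2 le_rfl) (mem_Ici.2 hT0)
  rw [h0, sub_zero, sub_zero, abs_of_nonneg hT0] at hl
  have hfT := abs_sigDeriv_sub_le hf le_rfl hT0
  have hmul : R₁ + (γ - L) * T ≤ (γ - L) * (τ - T) := by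
    have := mul_le_mul_of_nonneg_left hτ hd.le
    rw [mul_add, mul_div_cancel₀ _ hd.ne'] at this
    linarith
  -- Before T nothing is used about `y_m`: the output leaves 0 at speed at most γ. The excess over
  -- 2LT is then (γ - L)T + R₁, which is removed in a further time T + R₁/(γ - L).
  have htri : |filteredDiff L Tbar γ 0 (f + η) T - sigDeriv f T| ≤ γ * T + (L * T + R₁) := by
    rw [abs_le] at *
    constructor <;> linarith
  linarith

lemma abs_filteredDiff_sub_le_of_init (hL : 0 < L) (hγ : L < γ) (hTbar : 0 < Tbar)
    (ht₀ : 0 < t₀) (hN : 0 ≤ N) (hTb : ENNReal.ofReal (settlingTime L N) ≤ Tbar)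
    (hf : f ∈ signalClass L) (hη : η ∈ noiseClass N) :
    |filteredDiff L Tbar γ t₀ (f + η) t₀ - sigDeriv f t₀| ≤ errorBound L N t₀ := by
  rw [(filteredDiff_isFilippovSolution L Tbar (hL.trans hγ) t₀ (f + η)).1]
  exact abs_outM_sub_le hL hN hTbar hf hη hTb ht₀

lemma abs_filteredDiff_sub_le_of_settlingTime_le (hL : 0 < L) (hγ : L < γ) (hTbar : 0 < Tbar)
    (ht₀ : 0 < t₀) (hN : 0 ≤ N) (hTb : ENNReal.ofReal (settlingTime L N) ≤ Tbar)
    (hf : f ∈ signalClass L) (hη : η ∈ noiseClass N) (hT : settlingTime L N ≤ t₀) {τ : ℝ}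
    (hτ : t₀ ≤ τ) :
    |filteredDiff L Tbar γ t₀ (f + η) τ - sigDeriv f τ| ≤ 2 * L * settlingTime L N := by
  have h0 := abs_filteredDiff_sub_le_of_init hL hγ hTbar ht₀ hN hTb hf hη
  rw [errorBound_of_le hL hN hT] at h0
  refine (filteredDiff_tracking_of_settlingTime_le hL hγ hTbar ht₀.le hN hTb hf hη le_rfl hT
    hτ).trans (max_le le_rfl ?_)
  linarith [mul_nonneg (sub_nonneg.2 hγ.le) (sub_nonneg.2 hτ)]

lemma errorBound_antitoneOn (hL : 0 < L) (hN : 0 ≤ N) {s t : ℝ} (hs : 0 < s) (hst : s ≤ t)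
    (ht : t ≤ settlingTime L N) : errorBound L N t ≤ errorBound L N s := by
  have ht0 := hs.trans_le hst
  rw [errorBound, errorBound, min_eq_left ht, min_eq_left (hst.trans ht)]
  have h1 : s * t ≤ settlingTime L N ^ 2 := by nlinarith
  have h2 : L * (s * t) ≤ 2 * N := by
    rw [← settlingTime_sq hL hN]
    exact mul_le_mul_of_nonneg_left h1 hL.le
  have h3 : L * s + 2 * N / s - (L * t + 2 * N / t) = (t - s) * (2 * N - L * (s * t)) / (s * t) := by
    field_simp
    ring
  have h4 : 0 ≤ (t - s) * (2 * N - L * (s * t)) / (s * t) :=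
    div_nonneg (mul_nonneg (by linarith) (by linarith)) (by positivity)
  linarith

lemma settlingTime_add_le {γ : ℝ} (hL : 0 < L) (hγ : L < γ) (ht₀ : 0 < t₀) (hN : 0 ≤ N)
    (hT : t₀ ≤ settlingTime L N) :
    settlingTime L N ≤ 2 * settlingTime L N + (2 * N / t₀ - γ * t₀) / (γ - L) := by
  have hd : 0 < γ - L := sub_pos.2 hγ
  have h1 : L * settlingTime L N ≤ 2 * N / t₀ := by
    rw [le_div_iff₀ ht₀, ← settlingTime_sq hL hN]
    nlinarith [mul_nonneg hL.le (settlingTime_nonneg L N)]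
  have h2 : -settlingTime L N ≤ (2 * N / t₀ - γ * t₀) / (γ - L) := by
    rw [le_div_iff₀ hd]
    nlinarith
  linarith

/-- On [t₀, h] the accuracy of `y_m` improves, so the initial error Lt₀ + 2N/t₀ is never exceeded;
after h it shrinks to 2Lh. The stated time is slightly generous, using (γ + L)t₀ ≤ (γ + L)h. -/
lemma abs_filteredDiff_sub_le_of_lt_settlingTime (hL : 0 < L) (hγ : L < γ) (hTbar : 0 < Tbar)
    (ht₀ : 0 < t₀) (hN : 0 ≤ N) (hTb : ENNReal.ofReal (settlingTime L N) ≤ Tbar)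
    (hf : f ∈ signalClass L) (hη : η ∈ noiseClass N) (hT : t₀ ≤ settlingTime L N) {τ : ℝ}
    (hτ : 2 * settlingTime L N + (2 * N / t₀ - γ * t₀) / (γ - L) ≤ τ) :
    |filteredDiff L Tbar γ t₀ (f + η) τ - sigDeriv f τ| ≤ 2 * L * settlingTime L N := by
  have hd : 0 < γ - L := sub_pos.2 hγ
  have h0 := abs_filteredDiff_sub_le_of_init hL hγ hTbar ht₀ hN hTb hf hη
  have h1 : |filteredDiff L Tbar γ t₀ (f + η) (settlingTime L N) -
      sigDeriv f (settlingTime L N)| ≤ errorBound L N t₀ := by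
    refine (filteredDiff_tracking hL hγ ht₀.le hf le_rfl hT fun t ht =>
      (abs_outM_sub_le hL hN hTbar hf hη hTb (ht₀.trans ht.1)).trans
        (errorBound_antitoneOn hL hN ht₀ ht.1.le ht.2.le)).trans (max_le le_rfl ?_)
    linarith [mul_nonneg hd.le (sub_nonneg.2 hT)]
  refine (filteredDiff_tracking_of_settlingTime_le hL hγ hTbar ht₀.le hN hTb hf hη hT le_rfl
    ((settlingTime_add_le hL hγ ht₀ hN hT).trans hτ)).trans (max_le le_rfl ?_)
  rw [errorBound, min_eq_left hT] at h1
  have hmul := mul_le_mul_of_nonneg_left hτ hd.le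
  rw [mul_add, mul_div_cancel₀ _ hd.ne'] at hmul
  have hprod : (γ + L) * t₀ ≤ (γ + L) * settlingTime L N :=
    mul_le_mul_of_nonneg_left hT (by linarith)
  linarith

lemma worstCaseError_le {D : (ℝ → ℝ) → ℝ → ℝ} {R₀ R₁ t C : ℝ}
    (h : ∀ f ∈ signalClassInit L R₀ R₁, ∀ η ∈ noiseClass N, ∀ τ, t ≤ τ →
      |D (f + η) τ - sigDeriv f τ| ≤ C) :
    worstCaseError D L R₀ R₁ N t ≤ ENNReal.ofReal C := by
  refine iSup₂_le fun f hf => iSup₂_le fun η hη => iSup₂_le fun τ hτ =>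
    ENNReal.ofReal_le_ofReal ?_
  rw [abs_sub_comm]
  exact h f hf η hη τ hτ

/-- Since N = Lh²/2, the restriction on the noise makes h an admissible window. -/
lemma ofReal_settlingTime_le (hL : 0 < L) (hN : 0 ≤ N)
    (h : ENNReal.ofReal N < ENNReal.ofReal L * Tbar ^ 2 / 2) :
    ENNReal.ofReal (settlingTime L N) ≤ Tbar := by
  by_contra! hlt
  refine absurd h (not_lt.2 ?_)
  have h2 : ENNReal.ofReal N =
      ENNReal.ofReal L * ENNReal.ofReal (settlingTime L N) ^ 2 / 2 := by
    rw [← ENNReal.ofReal_pow (settlingTime_nonneg L N), ← ENNReal.ofReal_mul hL.le,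
      settlingTime_sq hL hN, ← ENNReal.ofReal_ofNat 2, ← ENNReal.ofReal_div_of_pos two_pos]
    congr 1
    ring
  rw [h2]
  gcongr

lemma accuracy_eq (hL : 0 < L) :
    2 * √2 * √(N * L) = 2 * L * settlingTime L N := by
  have h1 : √2 * √(N * L) = L * settlingTime L N := by
    rw [settlingTime, ← Real.sqrt_mul (by norm_num), ← Real.sqrt_sq hL.le,
      ← Real.sqrt_mul (sq_nonneg _), Real.sqrt_sq hL.le]
    congr 1
    field_simp
  linarith

lemma settlingTime_le_iff (hL : 0 < L) (ht₀ : 0 < t₀) :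
    settlingTime L N ≤ t₀ ↔ N ≤ L * t₀ ^ 2 / 2 := by
  rw [settlingTime, Real.sqrt_le_left ht₀.le, div_le_iff₀ hL]
  constructor <;> intro h <;> linarith

lemma settlingTime_zero (L : ℝ) : settlingTime L 0 = 0 := by simp [settlingTime]

lemma mem_noiseClass_zero : (0 : ℝ → ℝ) ∈ noiseClass 0 := fun t _ => by simp

lemma isConvergenceTimeFunction_of_init_zero (hL : 0 < L) (hγ : L < γ) (hTbar : 0 < Tbar) :
    IsConvergenceTimeFunction (filteredDiff L Tbar γ 0) L (2 * √2)
      (ENNReal.ofReal L * Tbar ^ 2 / 2) (fun _ R₁ N => 2 * √(2 * N / L) + R₁ / (γ - L)) := by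
  intro R₀ R₁ _ hR₁
  refine ⟨by fun_prop, fun N hN hNb => ⟨?_, ?_⟩⟩
  · have := div_nonneg hR₁ (sub_nonneg.2 hγ.le)
    positivity
  · rw [accuracy_eq hL]
    exact worstCaseError_le fun f hf η hη τ hτ => abs_filteredDiff_sub_le_of_init_zero hL hγ hTbar
      hN (ofReal_settlingTime_le hL hN hNb) hf.1 hη hf.2.2 hτ

lemma exactInFiniteTime_of_init_zero (hL : 0 < L) (hγ : L < γ) (hTbar : 0 < Tbar) :
    ExactInFiniteTime (filteredDiff L Tbar γ 0) L := by
  intro R₀ R₁ _ hR₁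
  have hR := div_nonneg hR₁ (sub_nonneg.2 hγ.le)
  -- The 1 keeps the time positive when R₁ = 0.
  refine ⟨R₁ / (γ - L) + 1, by positivity, le_antisymm ?_ zero_le⟩
  rw [← ENNReal.ofReal_zero]
  refine worstCaseError_le fun f hf η hη τ hτ => ?_
  have := abs_filteredDiff_sub_le_of_init_zero hL hγ hTbar le_rfl
    (by simp [settlingTime_zero]) hf.1 hη hf.2.2 (τ := τ) (by rw [settlingTime_zero]; linarith)
  simpa [settlingTime_zero] using this

lemma isConvergenceTimeFunction_of_init_pos (hL : 0 < L) (hγ : L < γ) (hTbar : 0 < Tbar)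
    (ht₀ : 0 < t₀) :
    IsConvergenceTimeFunction (filteredDiff L Tbar γ t₀) L (2 * √2)
      (ENNReal.ofReal L * Tbar ^ 2 / 2) (fun _ _ N =>
          if N ≤ L * t₀ ^ 2 / 2 then t₀
          else 2 * √(2 * N / L) + (2 * N / t₀ - γ * t₀) / (γ - L)) := by
  intro R₀ R₁ _ _
  have hd : 0 < γ - L := sub_pos.2 hγ
  refine ⟨Continuous.continuousOn (Continuous.if_le (by fun_prop) (by fun_prop) (by fun_prop)
    (by fun_prop) fun N hN => ?_), fun N hN hNb => ?_⟩
  -- At the switch h = t₀ the second branch is 2t₀ + (L - γ)t₀/(γ - L) = t₀, so the branches agree.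
  · have h1 : 2 * N / L = t₀ ^ 2 := by rw [hN]; field_simp
    rw [h1, Real.sqrt_sq ht₀.le, hN]
    field_simp
    ring
  · have hTb := ofReal_settlingTime_le hL hN hNb
    rw [accuracy_eq hL]
    dsimp only
    split_ifs with h
    · exact ⟨ht₀.le, worstCaseError_le fun f hf η hη τ hτ =>
        abs_filteredDiff_sub_le_of_settlingTime_le hL hγ hTbar ht₀ hN hTb hf.1 hη
          ((settlingTime_le_iff hL ht₀).2 h) hτ⟩
    · have hT : t₀ ≤ settlingTime L N :=
        (not_le.1 fun h' => h ((settlingTime_le_iff hL ht₀).1 h')).le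
      exact ⟨(settlingTime_nonneg L N).trans (settlingTime_add_le hL hγ ht₀ hN hT),
        worstCaseError_le fun f hf η hη τ hτ =>
          abs_filteredDiff_sub_le_of_lt_settlingTime hL hγ hTbar ht₀ hN hTb hf.1 hη hT hτ⟩

lemma exactInFixedTime_of_init_pos (hL : 0 < L) (hγ : L < γ) (hTbar : 0 < Tbar)
    (ht₀ : 0 < t₀) : ExactInFixedTime (filteredDiff L Tbar γ t₀) L := by
  refine ⟨t₀, ht₀, fun R₀ R₁ _ _ => le_antisymm ?_ zero_le⟩
  rw [← ENNReal.ofReal_zero]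
  refine worstCaseError_le fun f hf η hη τ hτ => ?_
  have := abs_filteredDiff_sub_le_of_settlingTime_le hL hγ hTbar ht₀ le_rfl
    (by simp [settlingTime_zero]) hf.1 hη (by rw [settlingTime_zero]; exact ht₀.le) hτ
  simpa [settlingTime_zero] using this

/-! ### Robustness -/

lemma outM_eq_sigDeriv (hL : 0 < L) (hTbar : 0 < Tbar) (hf : f ∈ signalClass L) {t : ℝ}
    (ht : 0 < t) : outM L Tbar f t = sigDeriv f t := by
  have := abs_outM_sub_le hL le_rfl hTbar hf mem_noiseClass_zero (by simp [settlingTime_zero]) ht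
  rw [errorBound_zero ht.le, add_zero] at this
  exact sub_eq_zero.1 (abs_nonpos_iff.1 this)

/-- After h the two tracked functions differ by at most 2Lh, and comparison of solutions preserves a
gap of 2γh. If t₀ = 0, both outputs start at 0 with speed at most γ, so the gap is at most 2γh up to
time h. -/
lemma abs_filteredDiff_sub_filteredDiff_le (hL : 0 < L) (hγ : L < γ) (hTbar : 0 < Tbar)
    (ht₀ : 0 ≤ t₀) (hN : 0 ≤ N) (hTb : ENNReal.ofReal (settlingTime L N) ≤ Tbar)
    (hT : 0 < t₀ → settlingTime L N ≤ t₀) (hf : f ∈ signalClass L) (hη : η ∈ noiseClass N)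
    (τ : ℝ) :
    |filteredDiff L Tbar γ t₀ f τ - filteredDiff L Tbar γ t₀ (f + η) τ| ≤
      2 * γ * settlingTime L N := by
  have hγ0 := hL.trans hγ
  have hT0 := settlingTime_nonneg L N
  have hb0 : 0 ≤ 2 * γ * settlingTime L N := by positivity
  have hbL : 2 * L * settlingTime L N ≤ 2 * γ * settlingTime L N := by gcongr
  rcases lt_or_ge τ t₀ with hτ | hτ
  · rw [filteredDiff_of_lt L Tbar hγ0 hτ, filteredDiff_of_lt L Tbar hγ0 hτ]
    simpa using hb0
  have hy := filteredDiff_isFilippovSolution L Tbar hγ0 t₀ f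
  have hz := filteredDiff_isFilippovSolution L Tbar hγ0 t₀ (f + η)
  have hm : ∀ t, 0 < t → settlingTime L N ≤ t →
      |outM L Tbar f t - outM L Tbar (f + η) t| ≤ 2 * γ * settlingTime L N := by
    intro t ht htT
    rw [outM_eq_sigDeriv hL hTbar hf ht, abs_sub_comm]
    refine (abs_outM_sub_le hL hN hTbar hf hη hTb ht).trans ?_
    rwa [errorBound_of_le hL hN htT]
  have key : ∀ a, t₀ ≤ a → settlingTime L N ≤ a → a ≤ τ →
      |filteredDiff L Tbar γ t₀ f a - filteredDiff L Tbar γ t₀ (f + η) a| ≤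
        2 * γ * settlingTime L N →
      |filteredDiff L Tbar γ t₀ f τ - filteredDiff L Tbar γ t₀ (f + η) τ| ≤
        2 * γ * settlingTime L N := by
    intro a ha haT haτ hinit
    rw [abs_le] at hinit ⊢
    have hm' := fun t (ht : t ∈ Ioo a τ) =>
      abs_le.1 (hm t (lt_of_le_of_lt (ht₀.trans ha) ht.1) (haT.trans ht.1.le))
    constructor
    · linarith [hz.relay_le_add hγ0 hy (c := 2 * γ * settlingTime L N) ha haτ
        (fun t ht => by linarith [(hm' t ht).1]) (by linarith)]
    · linarith [hy.relay_le_add hγ0 hz (c := 2 * γ * settlingTime L N) ha haτ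
        (fun t ht => by linarith [(hm' t ht).2]) (by linarith)]
  rcases ht₀.eq_or_lt with rfl | ht₀'
  · have hshort : ∀ t, 0 ≤ t → t ≤ settlingTime L N →
        |filteredDiff L Tbar γ 0 f t - filteredDiff L Tbar γ 0 (f + η) t| ≤
          2 * γ * settlingTime L N := by
      intro t ht htT
      have hinit : ∀ u, filteredDiff L Tbar γ 0 u 0 = 0 := fun u => by
        rw [(filteredDiff_isFilippovSolution L Tbar hγ0 0 u).1]
        simp [outM, regularization, outW]
      have hl := fun u => abs_sub_le_of_lipschitzOnWith hγ0.le
        (filteredDiff_lipschitzOnWith L Tbar hγ0 0 u) (mem_Ici.2 le_rfl) (mem_Ici.2 ht)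
      simp only [hinit, sub_zero, abs_of_nonneg ht] at hl
      have h1 := mul_le_mul_of_nonneg_left htT hγ0.le
      linarith [abs_sub (filteredDiff L Tbar γ 0 f t) (filteredDiff L Tbar γ 0 (f + η) t), hl f,
        hl (f + η)]
    rcases le_total τ (settlingTime L N) with h | h
    · exact hshort τ hτ h
    · exact key _ hT0 le_rfl h (hshort _ hT0 le_rfl)
  · refine key t₀ le_rfl (hT ht₀') hτ ?_
    rw [hy.1, hz.1]
    exact hm t₀ ht₀' (hT ht₀')

lemma robustFromBeginning_filteredDiff (hL : 0 < L) (hγ : L < γ) (hTbar : 0 < Tbar)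
    (ht₀ : 0 ≤ t₀) : RobustFromBeginning (filteredDiff L Tbar γ t₀) L := by
  intro R₀ R₁ _ _
  have hT : Tendsto (fun N => settlingTime L N) (𝓝[>] 0) (𝓝 0) := by
    have : Continuous (settlingTime L) := by unfold settlingTime; fun_prop
    simpa [settlingTime_zero] using (this.tendsto 0).mono_left nhdsWithin_le_nhds
  have hTE : Tendsto (fun N => ENNReal.ofReal (settlingTime L N)) (𝓝[>] 0) (𝓝 0) := by
    simpa [Function.comp_def] using (ENNReal.continuous_ofReal.tendsto 0).comp hT
  have hbound : Tendsto (fun N => ENNReal.ofReal (2 * γ * settlingTime L N)) (𝓝[>] 0) (𝓝 0) := by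
    have h1 := hT.const_mul (2 * γ)
    rw [mul_zero] at h1
    simpa [Function.comp_def] using (ENNReal.continuous_ofReal.tendsto 0).comp h1
  refine le_antisymm ?_ zero_le
  rw [← hbound.limsup_eq]
  refine limsup_le_limsup ?_
  -- Only small N matters in the limit, so for t₀ > 0 the time before h can be avoided.
  have hsmall : ∀ᶠ N in 𝓝[>] (0 : ℝ), 0 < t₀ → settlingTime L N ≤ t₀ := by
    by_cases h : 0 < t₀
    · filter_upwards [hT.eventually_lt_const h] with N hN _ using hN.le
    · exact Eventually.of_forall fun N h' => absurd h' h
  filter_upwards [hsmall, hTE.eventually_lt_const hTbar, self_mem_nhdsWithin] with N h1 h2 h3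
  refine iSup₂_le fun f hf => iSup₂_le fun η hη => iSup₂_le fun τ _ =>
    ENNReal.ofReal_le_ofReal ?_
  exact abs_filteredDiff_sub_filteredDiff_le hL hγ hTbar ht₀ (le_of_lt h3) h2.le h1 hf.1 hη τ

end Convergence

end RobustDiff

open RobustDiff
theorem theorem1 (L γ t₀ : ℝ) (Tbar : ℝ≥0∞) (hL : 0 < L) (hγ : L < γ) (hTbar : 0 < Tbar)
    (ht₀ : 0 ≤ t₀) :
    -- `D` is a well-defined causal operator
    ((∀ u ∈ inputs, ∃! y, IsFilterOutput L Tbar γ t₀ u y) ∧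
      IsCausal (filteredDiff L Tbar γ t₀)) ∧
    -- (a) Lipschitz-continuous output
    (∀ u ∈ inputs,
      LipschitzOnWith γ.toNNReal (filteredDiff L Tbar γ t₀ u) (Ici t₀) ∧
      LipschitzOnWith γ.toNNReal (filteredDiff L Tbar γ t₀ u) (Ico 0 t₀)) ∧
    -- (b) initialization at time zero
    (t₀ = 0 →
      ExactInFiniteTime (filteredDiff L Tbar γ t₀) L ∧
      HasAccuracyBound (filteredDiff L Tbar γ t₀) L (2 * √2) (ENNReal.ofReal L * Tbar ^ 2 / 2) ∧
      IsConvergenceTimeFunction (filteredDiff L Tbar γ t₀) L (2 * √2)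
        (ENNReal.ofReal L * Tbar ^ 2 / 2)
        (fun _ R₁ N => 2 * √(2 * N / L) + R₁ / (γ - L))) ∧
    -- (c) initialization at a positive time
    (0 < t₀ →
      ExactInFixedTime (filteredDiff L Tbar γ t₀) L ∧
      HasAccuracyBound (filteredDiff L Tbar γ t₀) L (2 * √2) (ENNReal.ofReal L * Tbar ^ 2 / 2) ∧
      IsConvergenceTimeFunction (filteredDiff L Tbar γ t₀) L (2 * √2)
        (ENNReal.ofReal L * Tbar ^ 2 / 2)
        (fun _ _ N =>
          if N ≤ L * t₀ ^ 2 / 2 then t₀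
          else 2 * √(2 * N / L) + (2 * N / t₀ - γ * t₀) / (γ - L))) ∧
    -- (d) robustness
    RobustFromBeginning (filteredDiff L Tbar γ t₀) L := by 
  have hγ0 := hL.trans hγ
  refine ⟨⟨fun u _ => ?_, isCausal_filteredDiff L Tbar hγ0 ht₀⟩, fun u _ => ⟨?_, ?_⟩, ?_, ?_, ?_⟩
  · obtain ⟨y, hy⟩ := exists_isFilterOutput L Tbar hγ0 t₀ u
    exact ⟨y, hy, fun z hz => hz.unique hγ0 hy⟩
  · exact filteredDiff_lipschitzOnWith L Tbar hγ0 t₀ u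
  · refine (LipschitzOnWith.of_dist_le_mul fun s hs t ht => ?_)
    rw [filteredDiff_of_lt L Tbar hγ0 hs.2, filteredDiff_of_lt L Tbar hγ0 ht.2, dist_self]
    positivity
  · rintro rfl
    have h := isConvergenceTimeFunction_of_init_zero hL hγ hTbar
    exact ⟨exactInFiniteTime_of_init_zero hL hγ hTbar, ⟨_, h⟩, h⟩
  · intro ht
    have h := isConvergenceTimeFunction_of_init_pos hL hγ hTbar ht
    exact ⟨exactInFixedTime_of_init_pos hL hγ hTbar ht, ⟨_, h⟩, h⟩
  · exact robustFromBeginning_filteredDiff hL hγ hTbar ht₀
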